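/- Let $0<\kappa<1$ and $C>0$. Let $W^\uparrow$ and $\widetilde W^\uparrow$ be two independent copies of the Brownian motion with drift $-\kappa/2$ Doob-conditioned to stay positive, that is, of the continuous process started at $0$, positive on $(0,\infty)$, with generator $\frac12\frac{d^2}{dx^2}+\frac{\kappa}{2}\coth\left(\frac{\kappa}{2}x\right)\frac{d}{dx}$, and let $$\mathcal R_\kappa:=\int_0^\infty e^{-W^\uparrow(x)}\,dx+\int_0^\infty e^{-\widetilde W^\uparrow(x)}\,dx .$$ Let $\nu$ be the measure on $(0,\infty)^2$ such that, for all $x,y>0$, $$\nu\big([x,\infty)\times[y,\infty)\big)=\frac{C}{y^\kappa}\,\mathbb E\left[\mathcal R_\kappa^\kappa\,\mathbf 1_{\mathcal R_\kappa\le y/x}\right]+\frac{C}{x^\kappa}\,\mathbb P\left(\mathcal R_\kappa>\frac yx\right).$$ Let $(\mathcal Y_1,\mathcal Y_2)$ be a càdlàg two-dimensional Lévy process started at $0$ with values in $[0,\infty)^2$ which is a pure jump process (at each time it is the sum of its past jumps) with Lévy measure $\nu$. For a càdlàg function $f:[0,\infty)\to\mathbb R$ put $\Delta f(r):=f(r)-f(r^-)$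 (with $\Delta f(0):=0$), $$f^\natural(s):=\sup_{0\le r\le s}\Delta f(r),\qquad f^{-1}(a):=\inf\{x\ge 0: f(x)>a\},$$ and write $T:=\mathcal Y_2^{-1}(1)$. Define $$F^*:=\inf\left\{s\in(0,T):\ \Delta\mathcal Y_1(s)=\mathcal Y_1^\natural(T^-)\right\},\qquad \mathcal I_1:=\mathcal Y_1^\natural(T^-),\qquad \mathcal I_2:=\big(1-\mathcal Y_2(T^-)\big)\,\frac{\mathcal Y_1(T)-\mathcal Y_1(T^-)}{\mathcal Y_2(T)-\mathcal Y_2(T^-)} .$$ Then the random variable $F^*/T$ is uniformly distributed on $[0,1]$ and is independent of the pair $(\mathcal I_1,\mathcal I_2)$. -/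

import Mathlib

open MeasureTheory ProbabilityTheory Filter Topology
open scoped NNReal ENNReal

noncomputable section

namespace StableJump

/-! ### Functionals of càdlàg paths -/

/-- `f : [0, ∞) → E` is càdlàg: right-continuous with left limits (at `0` the existence of a left
limit is void, since `𝓝[<] 0 = ⊥`). -/
def IsCadlag {E : Type*} [TopologicalSpace E] (f : ℝ≥0 → E) : Prop :=
  ∀ t, ContinuousWithinAt f (Set.Ici t) t ∧ ∃ l, Tendsto f (𝓝[<] t) (𝓝 l)

/-- The jump `Δf(t) = f(t) - f(t⁻)`; in particular `Δf(0) = 0`. -/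
def jump {E : Type*} [TopologicalSpace E] [Sub E] (f : ℝ≥0 → E) (t : ℝ≥0) : E :=
  f t - Function.leftLim f t

/-- `f^♮(s) = sup_{0 ≤ r ≤ s} (f(r) - f(r⁻))`, the largest jump of `f` up to time `s`. -/
def largestJump (f : ℝ≥0 → ℝ) (s : ℝ≥0) : ℝ :=
  sSup (jump f '' Set.Iic s)

/-- `f⁻¹(a) = inf {x ≥ 0 : f(x) > a}`. -/
def firstAbove (f : ℝ≥0 → ℝ) (a : ℝ) : ℝ≥0 :=
  sInf {x | a < f x}

/-- `F*(f₁, f₂) = inf {s ∈ (0, f₂⁻¹(1)) : Δf₁(s) = f₁^♮(f₂⁻¹(1)⁻)}`. -/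
def Fstar (f₁ f₂ : ℝ≥0 → ℝ) : ℝ≥0 :=
  sInf {s | s ∈ Set.Ioo 0 (firstAbove f₂ 1) ∧
    jump f₁ s = Function.leftLim (largestJump f₁) (firstAbove f₂ 1)}

/-- `f₁^♮(f₂⁻¹(1)⁻)`, the largest jump of `f₁` strictly before `f₂⁻¹(1)`. -/
def I₁ (f₁ f₂ : ℝ≥0 → ℝ) : ℝ :=
  Function.leftLim (largestJump f₁) (firstAbove f₂ 1)

/-- `(1 - f₂(T⁻)) (f₁(T) - f₁(T⁻)) / (f₂(T) - f₂(T⁻))` with `T = f₂⁻¹(1)`. -/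
def I₂ (f₁ f₂ : ℝ≥0 → ℝ) : ℝ :=
  (1 - Function.leftLim f₂ (firstAbove f₂ 1)) *
    (jump f₁ (firstAbove f₂ 1) / jump f₂ (firstAbove f₂ 1))

/-! ### The variable `R_κ` -/

/-- The drift `(κ/2) coth(κ x / 2)`. -/
def besselDrift (κ x : ℝ) : ℝ :=
  κ / 2 * (Real.cosh (κ / 2 * x) / Real.sinh (κ / 2 * x))

/-- `W` is the Brownian motion with drift `-κ/2` Doob-conditioned to stay positive, i.e. the
`3`-dimensional `(κ/2)`-drifted Bessel process started at `0`: the continuous process, positive on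
`(0, ∞)`, with generator `(1/2) d²/dx² + (κ/2) coth(κ x / 2) d/dx`, given as the solution of
`dW = dB + (κ/2) coth(κ W / 2) ds`, `W(0) = 0`, with `B` a standard Brownian motion. -/
structure IsConditionedBM {Ω : Type*} [MeasurableSpace Ω] (κ : ℝ) (W : ℝ≥0 → Ω → ℝ)
    (P : Measure Ω) : Prop where
  measurable : ∀ t, Measurable (W t)
  continuous : ∀ ω, Continuous (W · ω)
  zero : ∀ᵐ ω ∂P, W 0 ω = 0
  pos : ∀ᵐ ω ∂P, ∀ t, 0 < t → 0 < W t ω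
  integrable : ∀ᵐ ω ∂P, ∀ t : ℝ≥0,
    IntervalIntegrable (fun s : ℝ ↦ besselDrift κ (W s.toNNReal ω)) volume 0 t
  brownian : IsBrownianReal
    (fun (t : ℝ≥0) ω ↦ W t ω - ∫ s in (0 : ℝ)..t, besselDrift κ (W s.toNNReal ω)) P

/-- `∫₀^∞ e^{-W(x)} dx + ∫₀^∞ e^{-W'(x)} dx`, as an element of `[0, ∞]`. -/
def expFunctional {Ω : Type*} (W W' : ℝ≥0 → Ω → ℝ) (ω : Ω) : ℝ≥0∞ :=
  (∫⁻ x in Set.Ioi (0 : ℝ), ENNReal.ofReal (Real.exp (-W x.toNNReal ω))) +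
    ∫⁻ x in Set.Ioi (0 : ℝ), ENNReal.ofReal (Real.exp (-W' x.toNNReal ω))

/-! ### The Lévy process -/

/-- `ν` is the measure on `(0, ∞)²` with
`ν([x, ∞) × [y, ∞)) = C y^{-κ} E[R^κ 1_{R ≤ y/x}] + C x^{-κ} P(R > y/x)` for `x, y > 0`. -/
structure IsStableMeasure {Ω : Type*} [MeasurableSpace Ω] (κ C : ℝ) (R : Ω → ℝ≥0∞)
    (P : Measure Ω) (ν : Measure (ℝ × ℝ)) : Prop where
  compl : ν (Set.Ioi 0 ×ˢ Set.Ioi 0)ᶜ = 0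
  quadrant : ∀ x y : ℝ, 0 < x → 0 < y →
    ν (Set.Ici x ×ˢ Set.Ici y) =
      ENNReal.ofReal (C / y ^ κ) * (∫⁻ ω in {ω | R ω ≤ ENNReal.ofReal (y / x)}, R ω ^ κ ∂P) +
      ENNReal.ofReal (C / x ^ κ) * P {ω | ENNReal.ofReal (y / x) < R ω}

/-- A Lévy process in a topological group `E`, with all its paths càdlàg. -/
structure IsLevyProcess {Ω E : Type*} [MeasurableSpace Ω] [TopologicalSpace E] [AddGroup E]
    [MeasurableSpace E] (Y : ℝ≥0 → Ω → E) (P : Measure Ω) : Prop where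
  measurable : ∀ t, Measurable (Y t)
  cadlag : ∀ ω, IsCadlag (Y · ω)
  zero : ∀ᵐ ω ∂P, Y 0 ω = 0
  indep : HasIndepIncrements Y P
  stationary : ∀ s h, IdentDistrib (fun ω ↦ Y (s + h) ω - Y s ω) (Y h) P P

/-- `ν` is the Lévy measure of `Y`: for every Borel set `A` that does not contain `0`, `ν(A)` is
the expected number of jumps of `Y` in the time interval `(0, 1]` whose size lies in `A`. -/
def IsLevyMeasure {Ω E : Type*} [MeasurableSpace Ω] [TopologicalSpace E] [AddGroup E]
    [MeasurableSpace E] (ν : Measure E) (Y : ℝ≥0 → Ω → E) (P : Measure Ω) : Prop :=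
  ∀ A : Set E, MeasurableSet A → (0 : E) ∉ A →
    ν A = ∫⁻ ω, ({s : ℝ≥0 | s ∈ Set.Ioc 0 1 ∧ jump (Y · ω) s ∈ A}.encard : ℝ≥0∞) ∂P

/-- `Y` is a pure jump process: almost surely, at every time it is the sum of its past jumps. -/
def IsPureJump {Ω E : Type*} [MeasurableSpace Ω] [TopologicalSpace E] [AddCommGroup E]
    (Y : ℝ≥0 → Ω → E) (P : Measure Ω) : Prop :=
  ∀ᵐ ω ∂P, ∀ t : ℝ≥0, HasSum (fun s : Set.Iic t ↦ jump (Y · ω) s) (Y t ω)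

end StableJump

end

/-!
Along a grid of mesh `δ`, the increments of `(Y₁, Y₂)` are exchangeable. Let `k` be the index of the
increment during which `Y₂` crosses the level `1`. Exchanging two of the increments of index `< k`
changes neither `k`, nor the largest of the first `k` increments of `Y₁`, nor the data at the
crossing; hence, given all of these, the index of the largest increment is uniformly distributed. As
`δ → 0` this index divided by `k` tends to `F*/T` and the data tend to those of the passage of `Y₂`
above `1`, provided that the path of `Y₁` has a unique largest jump before `T` and that `T` is not
on the grid. The first property holds almost surely because the Lévy measure of `Y₁` is infinite and
has no atoms: the largest jumps over disjoint blocks of time are independent with atomless laws, so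
they are distinct. The second holds almost surely for suitable meshes, because the law of `T` has at
most countably many atoms.
-/

noncomputable section

namespace StableJump

/-! ### Jumps of nondecreasing right-continuous functions -/

section Jump

variable {f : ℝ≥0 → ℝ} {s : ℝ≥0}

lemma jump_nonneg (hf : Monotone f) (s : ℝ≥0) : 0 ≤ jump f s :=
  sub_nonneg.2 (hf.leftLim_le le_rfl)

lemma jump_le_sub (hf : Monotone f) {l r : ℝ≥0} (hl : l < s) (hr : s ≤ r) :
    jump f s ≤ f r - f l :=
  sub_le_sub (hf hr) (hf.le_leftLim hl)

lemma jump_zero (f : ℝ≥0 → ℝ) : jump f 0 = 0 := by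
  rw [jump, leftLim_eq_of_isBot (fun _ ↦ zero_le), sub_self]

lemma tendsto_jump_nhdsNE (hf : Monotone f) (hc : ContinuousWithinAt f (Set.Ici s) s) :
    Tendsto (jump f) (𝓝[≠] s) (𝓝 0) := by
  rw [← Set.Iio_union_Ioi, nhdsWithin_union]
  refine Tendsto.sup ?_ ?_
  · have h : Tendsto (fun t ↦ Function.leftLim f s - Function.leftLim f t) (𝓝[<] s) (𝓝 0) := by
      have hleft := hf.leftLim.tendsto_leftLim s
      rw [leftLim_leftLim (hf.tendsto_leftLim s)] at hleft
      simpa using hleft.const_sub (Function.leftLim f s)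
    refine squeeze_zero' (Eventually.of_forall (jump_nonneg hf)) ?_ h
    filter_upwards [self_mem_nhdsWithin] with t ht
    exact sub_le_sub_right (hf.le_leftLim ht) _
  · have h : Tendsto (fun t ↦ f t - f s) (𝓝[>] s) (𝓝 0) := by
      simpa using (hc.mono Set.Ioi_subset_Ici_self).sub_const (f s)
    refine squeeze_zero' (Eventually.of_forall (jump_nonneg hf)) ?_ h
    filter_upwards [self_mem_nhdsWithin] with t ht
    exact jump_le_sub hf ht le_rfl

lemma upperSemicontinuous_jump (hf : Monotone f)
    (hc : ∀ s, ContinuousWithinAt f (Set.Ici s) s) : UpperSemicontinuous (jump f) := by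
  intro s y hy
  have h := (tendsto_jump_nhdsNE hf (hc s)).eventually_lt_const ((jump_nonneg hf s).trans_lt hy)
  filter_upwards [eventually_nhdsWithin_iff.1 h] with t ht
  rcases eq_or_ne t s with rfl | hts
  exacts [hy, ht hts]

lemma exists_isMaxOn_jump (hf : Monotone f) (hc : ∀ s, ContinuousWithinAt f (Set.Ici s) s)
    {T : ℝ≥0} (hs : s ∈ Set.Ioo 0 T) (hpos : 0 < jump f s) :
    ∃ t ∈ Set.Ioo 0 T, 0 < jump f t ∧ IsMaxOn (jump f) (Set.Ioo 0 T) t := by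
  obtain ⟨c, ⟨hsc, hcT⟩, hsmall⟩ : ∃ c ∈ Set.Ico s T, ∀ u ∈ Set.Ioo c T, jump f u < jump f s := by
    have h := ((tendsto_jump_nhdsNE hf (hc T)).mono_left
      (nhdsWithin_mono T fun _ ↦ LT.lt.ne)).eventually_lt_const hpos
    exact (mem_nhdsLT_iff_exists_mem_Ico_Ioo_subset hs.2).1 h
  obtain ⟨t, htc, hmax⟩ := UpperSemicontinuousOn.exists_isMaxOn (s := Set.Icc 0 c)
    ⟨s, zero_le, hsc⟩ isCompact_Icc ((upperSemicontinuous_jump hf hc).upperSemicontinuousOn _)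
  have hst : jump f s ≤ jump f t := hmax ⟨zero_le, hsc⟩
  have ht0 : t ≠ 0 := by
    rintro rfl
    exact (hpos.trans_le hst).ne' (jump_zero f)
  refine ⟨t, ⟨pos_iff_ne_zero.2 ht0, htc.2.trans_lt hcT⟩, hpos.trans_le hst, fun u hu ↦ ?_⟩
  rcases le_or_gt u c with huc | hcu
  · exact hmax ⟨zero_le, huc⟩
  · exact (hsmall u ⟨hcu, hu.2⟩).le.trans hst

lemma tendsto_sub_jump {ι : Type*} {F : Filter ι} (hf : Monotone f)
    (hc : ContinuousWithinAt f (Set.Ici s) s) {l r : ι → ℝ≥0}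
    (hl : Tendsto l F (𝓝 s)) (hr : Tendsto r F (𝓝 s)) (hmem : ∀ᶠ i in F, s ∈ Set.Ioc (l i) (r i)) :
    Tendsto (fun i ↦ f (r i) - f (l i)) F (𝓝 (jump f s)) :=
  (Tendsto.comp hc (tendsto_nhdsWithin_iff.2 ⟨hr, hmem.mono fun _ h ↦ h.2⟩)).sub
    ((hf.tendsto_leftLim s).comp (tendsto_nhdsWithin_iff.2 ⟨hl, hmem.mono fun _ h ↦ h.1⟩))

lemma eventually_mem_Ioc_of_le_sub {ι : Type*} {F : Filter ι} (hf : Monotone f)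
    (hc : ContinuousWithinAt f (Set.Ici s) s) {l r : ι → ℝ≥0} {a : ℝ} (ha : 0 < a)
    (hlr : ∀ i, l i ≤ r i) (hl : Tendsto l F (𝓝 s)) (hr : Tendsto r F (𝓝 s))
    (hinc : ∀ i, a ≤ f (r i) - f (l i)) : ∀ᶠ i in F, s ∈ Set.Ioc (l i) (r i) := by
  have hright : ∀ᶠ u in 𝓝 s, s ≤ u → f u < f s + a :=
    eventually_nhdsWithin_iff.1 (hc.eventually_lt_const (lt_add_of_pos_right _ ha))
  have hleft : ∀ᶠ u in 𝓝 s, u < s → Function.leftLim f s - a < f u :=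
    eventually_nhdsWithin_iff.1 ((hf.tendsto_leftLim s).eventually_const_lt (sub_lt_self _ ha))
  filter_upwards [hr.eventually hright, hl.eventually hleft] with i hri hli
  constructor
  · by_contra! h
    linarith [hinc i, hri (h.trans (hlr i)), hf h]
  · by_contra! h
    linarith [hinc i, hli ((hlr i).trans_lt h), hf.le_leftLim h]

end Jump

/-! ### Increments over a grid -/

/-- The `j`-th interval of the grid of mesh `δ`. -/
def gridBlock (δ : ℝ≥0) (j : ℕ) : Set ℝ≥0 := Set.Ioc (j * δ) ((j + 1 : ℕ) * δ)

/-- The increment of `f` over `gridBlock δ j`. -/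
def gridIncr {E : Type*} [Sub E] (f : ℝ≥0 → E) (δ : ℝ≥0) (j : ℕ) : E :=
  f ((j + 1 : ℕ) * δ) - f (j * δ)

section Grid

variable {f : ℝ≥0 → ℝ} {δ s : ℝ≥0}

lemma exists_mem_gridBlock (hδ : 0 < δ) (hs : 0 < s) : ∃ j, s ∈ gridBlock δ j := by
  obtain ⟨j, hj⟩ : ∃ j, ⌈s / δ⌉₊ = j + 1 :=
    Nat.exists_eq_succ_of_ne_zero (Nat.ceil_pos.2 (div_pos hs hδ)).ne'
  refine ⟨j, (lt_div_iff₀ hδ).1 (Nat.lt_ceil.1 (by omega)), ?_⟩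
  rw [← hj]
  exact (div_le_iff₀ hδ).1 (Nat.le_ceil _)

lemma le_of_mem_gridBlock_of_le {t : ℝ≥0} {i j : ℕ} (hst : s ≤ t) (hs : s ∈ gridBlock δ i)
    (ht : t ∈ gridBlock δ j) : i ≤ j := by
  have : (i : ℝ≥0) < (j + 1 : ℕ) := lt_of_mul_lt_mul_right (hs.1.trans_le (hst.trans ht.2)) zero_le
  exact Nat.lt_succ_iff.1 (by exact_mod_cast this)

lemma eq_of_mem_gridBlock {i j : ℕ} (hi : s ∈ gridBlock δ i) (hj : s ∈ gridBlock δ j) : i = j :=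
  (le_of_mem_gridBlock_of_le le_rfl hi hj).antisymm (le_of_mem_gridBlock_of_le le_rfl hj hi)

lemma jump_le_gridIncr (hf : Monotone f) {j : ℕ} (hs : s ∈ gridBlock δ j) :
    jump f s ≤ gridIncr f δ j :=
  jump_le_sub hf hs.1 hs.2

lemma gridIncr_nonneg (hf : Monotone f) (δ : ℝ≥0) (j : ℕ) : 0 ≤ gridIncr f δ j :=
  sub_nonneg.2 (hf (by gcongr; omega))

lemma exists_gridIncr_crossing (hf : Monotone f) {a : ℝ} (h0 : f 0 ≤ a) (hex : ∃ x, a < f x)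
    (hδ : 0 < δ) : ∃ k : ℕ, f (k * δ) ≤ a ∧ a < f ((k + 1 : ℕ) * δ) := by
  classical
  have hex' : ∃ k : ℕ, a < f (k * δ) := by
    obtain ⟨x, hx⟩ := hex
    obtain ⟨k, hk⟩ := exists_nat_ge (x / δ)
    exact ⟨k, hx.trans_le (hf ((div_le_iff₀ hδ).1 hk))⟩
  have hne : Nat.find hex' ≠ 0 := fun h ↦ by
    have := Nat.find_spec hex'
    rw [h, Nat.cast_zero, zero_mul] at this
    exact this.not_ge h0
  obtain ⟨k, hk⟩ := Nat.exists_eq_succ_of_ne_zero hne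
  refine ⟨k, not_lt.1 (Nat.find_min hex' (by omega)), ?_⟩
  have := Nat.find_spec hex'
  rwa [hk] at this

section Limits

variable {δ : ℕ → ℝ≥0} {j : ℕ → ℕ}

lemma tendsto_left_gridBlock (hδ : Tendsto δ atTop (𝓝 0)) (hj : ∀ n, s ∈ gridBlock (δ n) (j n)) :
    Tendsto (fun n ↦ j n * δ n) atTop (𝓝 s) := by
  refine tendsto_of_tendsto_of_tendsto_of_le_of_le (g := fun n ↦ s - δ n) (h := fun _ ↦ s) ?_
    tendsto_const_nhds (fun n ↦ ?_) (fun n ↦ (hj n).1.le)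
  · simpa using tendsto_const_nhds.sub hδ
  · have h := (hj n).2
    rw [Nat.cast_succ, add_one_mul] at h
    exact tsub_le_iff_right.2 h

lemma tendsto_right_gridBlock (hδ : Tendsto δ atTop (𝓝 0)) (hj : ∀ n, s ∈ gridBlock (δ n) (j n)) :
    Tendsto (fun n ↦ (j n + 1 : ℕ) * δ n) atTop (𝓝 s) := by
  simpa [add_one_mul] using (tendsto_left_gridBlock hδ hj).add hδ

lemma tendsto_gridIncr (hf : Monotone f) (hc : ContinuousWithinAt f (Set.Ici s) s)
    (hδ : Tendsto δ atTop (𝓝 0)) (hj : ∀ n, s ∈ gridBlock (δ n) (j n)) :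
    Tendsto (fun n ↦ gridIncr f (δ n) (j n)) atTop (𝓝 (jump f s)) :=
  tendsto_sub_jump hf hc (tendsto_left_gridBlock hδ hj) (tendsto_right_gridBlock hδ hj)
    (Eventually.of_forall hj)

lemma tendsto_index_atTop (hδ : Tendsto δ atTop (𝓝 0)) (hs : 0 < s)
    (hj : ∀ n, s ∈ gridBlock (δ n) (j n)) : Tendsto j atTop atTop := by
  refine tendsto_atTop.2 fun N ↦ ?_
  have hN : Tendsto (fun n ↦ (N : ℝ≥0) * δ n) atTop (𝓝 0) := by
    simpa using tendsto_const_nhds.mul hδ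
  filter_upwards [hN.eventually_lt (tendsto_left_gridBlock hδ hj) hs] with n hn
  have : (N : ℝ≥0) < j n := lt_of_mul_lt_mul_right hn zero_le
  exact_mod_cast this.le

lemma tendsto_index_div_index {t : ℝ≥0} {k : ℕ → ℕ} (hδ₀ : ∀ n, 0 < δ n)
    (hδ : Tendsto δ atTop (𝓝 0)) (ht : 0 < t) (hj : ∀ n, s ∈ gridBlock (δ n) (j n))
    (hk : ∀ n, t ∈ gridBlock (δ n) (k n)) :
    Tendsto (fun n ↦ ((j n + 1 : ℕ) : ℝ) / k n) atTop (𝓝 ((s : ℝ) / t)) := by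
  have h := (NNReal.tendsto_coe.2 (tendsto_right_gridBlock hδ hj)).div
    (NNReal.tendsto_coe.2 (tendsto_left_gridBlock hδ hk)) (by exact_mod_cast ht.ne')
  refine h.congr fun n ↦ ?_
  have : (δ n : ℝ) ≠ 0 := by exact_mod_cast (hδ₀ n).ne'
  simp [mul_div_mul_right _ _ this]

lemma exists_jump_of_le_gridIncr (hf : Monotone f)
    (hc : ∀ s, ContinuousWithinAt f (Set.Ici s) s) (hδ : Tendsto δ atTop (𝓝 0)) {a : ℝ}
    (ha : 0 < a) {c : ℝ≥0} (hjc : ∀ n, (j n + 1 : ℕ) * δ n ≤ c)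
    (hinc : ∀ n, a ≤ gridIncr f (δ n) (j n)) :
    ∃ s, ∃ φ : ℕ → ℕ, StrictMono φ ∧ (∀ m, s ∈ gridBlock (δ (φ m)) (j (φ m))) ∧
      Tendsto (fun m ↦ gridIncr f (δ (φ m)) (j (φ m))) atTop (𝓝 (jump f s)) := by
  obtain ⟨s, -, φ, hφ, hls⟩ := (isCompact_Icc (a := (0 : ℝ≥0)) (b := c)).tendsto_subseq
    (x := fun n ↦ j n * δ n) (fun n ↦ ⟨zero_le, le_trans (by gcongr; omega) (hjc n)⟩)
  have hrs : Tendsto (fun m ↦ (j (φ m) + 1 : ℕ) * δ (φ m)) atTop (𝓝 s) := by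
    simpa [add_one_mul] using hls.add (hδ.comp hφ.tendsto_atTop)
  have hmem : ∀ᶠ m in atTop, s ∈ gridBlock (δ (φ m)) (j (φ m)) :=
    eventually_mem_Ioc_of_le_sub hf (hc s) ha (l := (fun n ↦ j n * δ n) ∘ φ)
      (fun m ↦ mul_le_mul_left (by exact_mod_cast Nat.le_succ _) _) hls hrs (fun m ↦ hinc (φ m))
  obtain ⟨N, hN⟩ := eventually_atTop.1 hmem
  exact ⟨s, fun m ↦ φ (m + N), fun x y hxy ↦ hφ (by omega), fun m ↦ hN _ (by omega),
    (tendsto_sub_jump hf (hc s) hls hrs hmem).comp (tendsto_add_atTop_nat N)⟩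

end Limits

end Grid

/-! ### First passage -/

section FirstPassage

variable {f : ℝ≥0 → ℝ} {a : ℝ}

lemma firstAbove_le {x : ℝ≥0} (hx : a < f x) : firstAbove f a ≤ x :=
  csInf_le (OrderBot.bddBelow _) hx

lemma lt_of_firstAbove_lt (hf : Monotone f) (hex : ∃ x, a < f x) {x : ℝ≥0}
    (hx : firstAbove f a < x) : a < f x := by
  obtain ⟨y, hy, hyx⟩ := exists_lt_of_csInf_lt (s := {x | a < f x}) hex hx
  exact lt_of_lt_of_le hy (hf hyx.le)

lemma firstAbove_pos (hf : Monotone f) (hc : ContinuousWithinAt f (Set.Ici 0) 0)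
    (h0 : f 0 < a) (hex : ∃ x, a < f x) : 0 < firstAbove f a := by
  have hlt : ∀ᶠ x in 𝓝[>] (0 : ℝ≥0), f x < a :=
    (hc.mono Set.Ioi_subset_Ici_self).eventually_lt_const h0
  obtain ⟨x, hx, hx0⟩ := (hlt.and self_mem_nhdsWithin).exists
  exact lt_of_lt_of_le (Set.mem_Ioi.1 hx0)
    (not_lt.1 fun h ↦ hx.not_gt (lt_of_firstAbove_lt hf hex h))

lemma exists_gridIncr_crossing_firstAbove (hf : Monotone f) (h0 : f 0 ≤ a) (hex : ∃ x, a < f x)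
    {δ : ℝ≥0} (hδ : 0 < δ) (hT : ∀ k : ℕ, firstAbove f a ≠ k * δ) :
    ∃ k : ℕ, firstAbove f a ∈ gridBlock δ k ∧ f (k * δ) ≤ a ∧ a < f ((k + 1 : ℕ) * δ) := by
  obtain ⟨k, hk, hk'⟩ := exists_gridIncr_crossing hf h0 hex hδ
  refine ⟨k, ⟨lt_of_le_of_ne (not_lt.1 fun h ↦ ?_) (hT k).symm, firstAbove_le hk'⟩, hk, hk'⟩
  exact (lt_of_firstAbove_lt hf hex h).not_ge hk

end FirstPassage

/-! ### The largest jump before the first passage -/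

/-- The `j`-th of the first `k` terms of `d` is strictly larger than the others. -/
def IsStrictMax (d : ℕ → ℝ) (k j : ℕ) : Prop :=
  j < k ∧ ∀ i < k, i ≠ j → d i < d j

/-- The increments `d` of a pair of paths such that the second path first exceeds `1` during step
`k`, the increment of the first path in step `j < k` being the strict maximum of those before
step `k`. -/
def crossingMax (k j : ℕ) : Set (ℕ → ℝ × ℝ) :=
  {d | (∑ i ∈ Finset.range k, (d i).2 ≤ 1 ∧ 1 < ∑ i ∈ Finset.range (k + 1), (d i).2) ∧
    IsStrictMax (fun i ↦ (d i).1) k j}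

/-- The discrete counterpart of `passageData` for increments in `crossingMax k j`: the largest first
coordinate before step `k`, the level reached before step `k`, and the increment in step `k`. -/
def crossingData (k j : ℕ) (d : ℕ → ℝ × ℝ) : ℝ × ℝ × ℝ × ℝ :=
  ((d j).1, ∑ i ∈ Finset.range k, (d i).2, d k)

/-- The position of the largest jump of `f₁` before the first passage of `f₂` above `1`, relative
to the passage time. -/
def relPosition (f₁ f₂ : ℝ≥0 → ℝ) : ℝ := (Fstar f₁ f₂ : ℝ) / firstAbove f₂ 1

/-- The largest jump of `f₁` before the passage time `T` of `f₂` above `1`, the left limit of `f₂`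
at `T`, and the jumps of `f₁` and `f₂` at `T`. -/
def passageData (f₁ f₂ : ℝ≥0 → ℝ) : ℝ × ℝ × ℝ × ℝ :=
  (I₁ f₁ f₂, Function.leftLim f₂ (firstAbove f₂ 1), jump f₁ (firstAbove f₂ 1),
    jump f₂ (firstAbove f₂ 1))

/-- The properties of the paths under which the grid increments determine `relPosition` and
`passageData` in the limit of vanishing mesh. -/
structure IsRegularPath (f₁ f₂ : ℝ≥0 → ℝ) : Prop where
  mono₁ : Monotone f₁
  mono₂ : Monotone f₂
  right₁ : ∀ s, ContinuousWithinAt f₁ (Set.Ici s) s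
  right₂ : ∀ s, ContinuousWithinAt f₂ (Set.Ici s) s
  zero₂ : f₂ 0 = 0
  exceeds : ∃ x, 1 < f₂ x
  jumps : ∀ ε > 0, ∃ s ∈ Set.Ioo 0 ε, 0 < jump f₁ s
  distinct : Set.InjOn (jump f₁) {s | 0 < jump f₁ s}

section LargestJump

variable {f f₁ f₂ : ℝ≥0 → ℝ} {s T : ℝ≥0}

lemma largestJump_eq (hf : Monotone f) (hmax : IsMaxOn (jump f) (Set.Ioo 0 T) s) {r : ℝ≥0}
    (hr : r ∈ Set.Ico s T) : largestJump f r = jump f s := by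
  refine IsGreatest.csSup_eq ⟨⟨s, hr.1, rfl⟩, ?_⟩
  rintro _ ⟨t, ht, rfl⟩
  rcases eq_or_lt_of_le (zero_le (a := t)) with rfl | h0
  · rw [jump_zero]
    exact jump_nonneg hf s
  · exact hmax ⟨h0, lt_of_le_of_lt ht hr.2⟩

lemma I₁_eq (hf : Monotone f₁) (hs : s ∈ Set.Ioo 0 (firstAbove f₂ 1))
    (hmax : IsMaxOn (jump f₁) (Set.Ioo 0 (firstAbove f₂ 1)) s) : I₁ f₁ f₂ = jump f₁ s := by
  have := nhdsLT_neBot_of_exists_lt ⟨s, hs.2⟩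
  refine leftLim_eq_of_tendsto (tendsto_const_nhds.congr' ?_)
  filter_upwards [Ico_mem_nhdsLT hs.2] with r hr
  exact (largestJump_eq hf hmax hr).symm

lemma Fstar_eq (hf : Monotone f₁) (hs : s ∈ Set.Ioo 0 (firstAbove f₂ 1))
    (hmax : IsMaxOn (jump f₁) (Set.Ioo 0 (firstAbove f₂ 1)) s)
    (huniq : ∀ t ∈ Set.Ioo 0 (firstAbove f₂ 1), jump f₁ t = jump f₁ s → t = s) :
    Fstar f₁ f₂ = s := by
  have hI : Function.leftLim (largestJump f₁) (firstAbove f₂ 1) = jump f₁ s := I₁_eq hf hs hmax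
  have : {t | t ∈ Set.Ioo 0 (firstAbove f₂ 1) ∧
      jump f₁ t = Function.leftLim (largestJump f₁) (firstAbove f₂ 1)} = {s} := by
    rw [hI]
    exact Set.eq_singleton_iff_unique_mem.2 ⟨⟨hs, rfl⟩, fun t ht ↦ huniq t ht.1 ht.2⟩
  rw [Fstar, this, csInf_singleton]

lemma eventually_gridIncr_lt (hf : Monotone f) (hc : ∀ s, ContinuousWithinAt f (Set.Ici s) s)
    (hpos : 0 < jump f s) (huniq : ∀ t ∈ Set.Ioo 0 T, jump f s ≤ jump f t → t = s)
    {δ : ℕ → ℝ≥0} (hδ : Tendsto δ atTop (𝓝 0)) {j k : ℕ → ℕ}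
    (hj : ∀ n, s ∈ gridBlock (δ n) (j n)) (hk : ∀ n, T ∈ gridBlock (δ n) (k n)) :
    ∀ᶠ n in atTop, ∀ i < k n, i ≠ j n →
      gridIncr f (δ n) i < gridIncr f (δ n) (j n) := by
  by_contra hcon
  have hfreq : ∃ᶠ n in atTop, ∃ i < k n, i ≠ j n ∧
      gridIncr f (δ n) (j n) ≤ gridIncr f (δ n) i := by
    simpa only [not_eventually, not_forall, not_lt, exists_prop] using hcon
  obtain ⟨ψ, hψ, hψ'⟩ := extraction_of_frequently_atTop hfreq
  choose i hik hij hi using hψ'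
  have hiT : ∀ m, ((i m + 1 : ℕ) : ℝ≥0) * δ (ψ m) < T := fun m ↦
    lt_of_le_of_lt (by gcongr; exact hik m) (hk (ψ m)).1
  have hle : ∀ m, jump f s ≤ gridIncr f (δ (ψ m)) (i m) := fun m ↦
    (jump_le_gridIncr hf (hj (ψ m))).trans (hi m)
  obtain ⟨t, φ, -, hmem, hlim⟩ := exists_jump_of_le_gridIncr hf hc (hδ.comp hψ.tendsto_atTop)
    hpos (fun m ↦ (hiT m).le) hle
  have hts : t = s := huniq t ⟨zero_le.trans_lt (hmem 0).1, (hmem 0).2.trans_lt (hiT _)⟩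
    (ge_of_tendsto' hlim fun m ↦ hle (φ m))
  exact hij (φ 0) (eq_of_mem_gridBlock (hts ▸ hmem 0) (hj _))

lemma eventually_isStrictMax (hf : Monotone f) (hc : ∀ s, ContinuousWithinAt f (Set.Ici s) s)
    (hsT : s < T) (hpos : 0 < jump f s)
    (huniq : ∀ t ∈ Set.Ioo 0 T, jump f s ≤ jump f t → t = s)
    {δ : ℕ → ℝ≥0} (hδ : Tendsto δ atTop (𝓝 0)) {j k : ℕ → ℕ}
    (hj : ∀ n, s ∈ gridBlock (δ n) (j n)) (hk : ∀ n, T ∈ gridBlock (δ n) (k n)) :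
    ∀ᶠ n in atTop, IsStrictMax (gridIncr f (δ n)) (k n) (j n) := by
  filter_upwards [(tendsto_left_gridBlock hδ hk).eventually_const_lt hsT,
    eventually_gridIncr_lt hf hc hpos huniq hδ hj hk] with n hn hlt
  have : (j n : ℝ≥0) < k n := lt_of_mul_lt_mul_right ((hj n).1.trans hn) zero_le
  exact ⟨by exact_mod_cast this, hlt⟩

namespace IsRegularPath

lemma firstAbove_pos (h : IsRegularPath f₁ f₂) : 0 < firstAbove f₂ 1 :=
  StableJump.firstAbove_pos h.mono₂ (h.right₂ 0) (by simp [h.zero₂]) h.exceeds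

lemma exists_unique_isMaxOn_jump (h : IsRegularPath f₁ f₂) :
    ∃ s ∈ Set.Ioo 0 (firstAbove f₂ 1), 0 < jump f₁ s ∧
      IsMaxOn (jump f₁) (Set.Ioo 0 (firstAbove f₂ 1)) s ∧
      ∀ t ∈ Set.Ioo 0 (firstAbove f₂ 1), jump f₁ s ≤ jump f₁ t → t = s := by
  obtain ⟨s₀, hs₀, hpos₀⟩ := h.jumps _ h.firstAbove_pos
  obtain ⟨s, hs, hpos, hmax⟩ := exists_isMaxOn_jump h.mono₁ h.right₁ hs₀ hpos₀
  exact ⟨s, hs, hpos, hmax, fun t ht hst ↦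
    h.distinct (hpos.trans_le hst) hpos ((hmax ht).antisymm hst)⟩

lemma gridIncr_snd_nonneg (h : IsRegularPath f₁ f₂) (δ : ℝ≥0) (j : ℕ) :
    0 ≤ (gridIncr (fun t ↦ (f₁ t, f₂ t)) δ j).2 :=
  gridIncr_nonneg h.mono₂ δ j

lemma sum_gridIncr_snd (h : IsRegularPath f₁ f₂) (δ : ℝ≥0) (k : ℕ) :
    ∑ i ∈ Finset.range k, (gridIncr (fun t ↦ (f₁ t, f₂ t)) δ i).2 = f₂ (k * δ) := by
  simpa [gridIncr, h.zero₂] using Finset.sum_range_sub (fun j : ℕ ↦ f₂ (j * δ)) k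

lemma exists_tendsto_crossingData (h : IsRegularPath f₁ f₂) {δ : ℕ → ℝ≥0}
    (hδ₀ : ∀ n, 0 < δ n) (hδ : Tendsto δ atTop (𝓝 0))
    (hT : ∀ n (k : ℕ), firstAbove f₂ 1 ≠ k * δ n) :
    ∃ k j : ℕ → ℕ,
      (∀ᶠ n in atTop, gridIncr (fun t ↦ (f₁ t, f₂ t)) (δ n) ∈ crossingMax (k n) (j n)) ∧
      Tendsto k atTop atTop ∧
      Tendsto (fun n ↦ ((j n + 1 : ℕ) : ℝ) / k n) atTop (𝓝 (relPosition f₁ f₂)) ∧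
      Tendsto (fun n ↦ crossingData (k n) (j n) (gridIncr (fun t ↦ (f₁ t, f₂ t)) (δ n))) atTop
        (𝓝 (passageData f₁ f₂)) := by
  obtain ⟨s, hs, hpos, hmax, huniq⟩ := h.exists_unique_isMaxOn_jump
  choose j hj using fun n ↦ exists_mem_gridBlock (hδ₀ n) hs.1
  choose k hk hle hlt using fun n ↦ exists_gridIncr_crossing_firstAbove h.mono₂
    (h.zero₂.trans_le zero_le_one) h.exceeds (hδ₀ n) (hT n)
  refine ⟨k, j, ?_, tendsto_index_atTop hδ h.firstAbove_pos hk, ?_, ?_⟩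
  · filter_upwards [eventually_isStrictMax h.mono₁ h.right₁ hs.2 hpos huniq hδ hj hk] with n hn
    refine ⟨?_, hn⟩
    rw [h.sum_gridIncr_snd, h.sum_gridIncr_snd]
    exact ⟨hle n, hlt n⟩
  · rw [relPosition, Fstar_eq h.mono₁ hs hmax fun t ht e ↦ huniq t ht e.ge]
    exact tendsto_index_div_index hδ₀ hδ h.firstAbove_pos hj hk
  · simp only [crossingData, h.sum_gridIncr_snd, passageData, I₁_eq h.mono₁ hs hmax]
    exact (tendsto_gridIncr h.mono₁ (h.right₁ s) hδ hj).prodMk_nhds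
      (((h.mono₂.tendsto_leftLim _).comp (tendsto_nhdsWithin_iff.2
        ⟨tendsto_left_gridBlock hδ hk, Eventually.of_forall fun n ↦ (hk n).1⟩)).prodMk_nhds
      ((tendsto_gridIncr h.mono₁ (h.right₁ _) hδ hk).prodMk_nhds
        (tendsto_gridIncr h.mono₂ (h.right₂ _) hδ hk)))

end IsRegularPath

end LargestJump

/-! ### Lévy processes -/

section LevyProcess

variable {Ω : Type*} [MeasurableSpace Ω] {P : Measure Ω}

section Map

variable {E F : Type*} [TopologicalSpace E] [TopologicalSpace F] [AddGroup E] [AddGroup F]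

lemma IsCadlag.map {f : ℝ≥0 → E} (hf : IsCadlag f) (L : E →ₜ+ F) : IsCadlag fun t ↦ L (f t) :=
  fun t ↦ ⟨(map_continuous L).continuousAt.comp_continuousWithinAt (hf t).1,
    let ⟨l, hl⟩ := (hf t).2; ⟨L l, ((map_continuous L).tendsto l).comp hl⟩⟩

lemma IsCadlag.jump_map [T2Space E] [T2Space F] {f : ℝ≥0 → E} (hf : IsCadlag f) (L : E →ₜ+ F)
    (t : ℝ≥0) : jump (fun s ↦ L (f s)) t = L (jump f t) := by
  rcases eq_or_neBot (𝓝[<] t) with h | h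
  · simp only [jump, leftLim_eq_of_eq_bot _ h, map_sub]
  · obtain ⟨l, hl⟩ := (hf t).2
    have hLl : Tendsto (fun s ↦ L (f s)) (𝓝[<] t) (𝓝 (L l)) :=
      ((map_continuous L).tendsto l).comp hl
    rw [jump, jump, leftLim_eq_of_tendsto hl, leftLim_eq_of_tendsto hLl, map_sub]

variable [MeasurableSpace E] [BorelSpace E] [MeasurableSpace F] [BorelSpace F] {Y : ℝ≥0 → Ω → E}

lemma IsLevyProcess.map (hY : IsLevyProcess Y P) (L : E →ₜ+ F) :
    IsLevyProcess (fun t ω ↦ L (Y t ω)) P where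
  measurable t := (map_continuous L).measurable.comp (hY.measurable t)
  cadlag ω := (hY.cadlag ω).map L
  zero := hY.zero.mono fun ω h ↦ by rw [h, map_zero]
  indep := hY.indep.map' (map_continuous L).measurable
  stationary s h := by
    simpa only [Function.comp_def, map_sub] using
      (hY.stationary s h).comp (map_continuous L).measurable

lemma IsLevyMeasure.map [T2Space E] [T2Space F] {ν : Measure E} (hν : IsLevyMeasure ν Y P)
    (hY : IsLevyProcess Y P) (L : E →ₜ+ F) :
    IsLevyMeasure (ν.map L) (fun t ω ↦ L (Y t ω)) P := fun A hA h0 ↦ by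
  have hL : Measurable L := (map_continuous L).measurable
  rw [Measure.map_apply hL hA, hν _ (hL hA) (by rwa [Set.mem_preimage, map_zero])]
  simp only [(hY.cadlag _).jump_map L, Set.mem_preimage]

end Map

section Increments

variable {E : Type*} [TopologicalSpace E] [AddGroup E] [MeasurableSpace E] {Y : ℝ≥0 → Ω → E}

lemma IsLevyProcess.measurable_gridIncr [MeasurableSub₂ E] (hY : IsLevyProcess Y P) (δ : ℝ≥0)
    (j : ℕ) : Measurable fun ω ↦ gridIncr (Y · ω) δ j :=
  (hY.measurable _).sub (hY.measurable _)

lemma IsLevyProcess.iIndepFun_gridIncr (hY : IsLevyProcess Y P) (δ : ℝ≥0) :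
    iIndepFun (fun j ω ↦ gridIncr (Y · ω) δ j) P :=
  hY.indep.nat (t := fun j : ℕ ↦ j * δ) (fun i j hij ↦ by dsimp only; gcongr)

lemma IsLevyProcess.identDistrib_gridIncr (hY : IsLevyProcess Y P) (δ : ℝ≥0) (j : ℕ) :
    IdentDistrib (fun ω ↦ gridIncr (Y · ω) δ j) (Y δ) P P := by
  simpa only [gridIncr, Nat.cast_succ, add_one_mul] using hY.stationary (j * δ) δ

lemma IsLevyProcess.measure_gridIncr_mem (hY : IsLevyProcess Y P) (δ : ℝ≥0) (j : ℕ) {B : Set E}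
    (hB : MeasurableSet B) : P {ω | gridIncr (Y · ω) δ j ∈ B} = P {ω | Y δ ω ∈ B} :=
  (hY.identDistrib_gridIncr δ j).measure_mem_eq hB

lemma IsLevyProcess.ae_frequently_gridIncr_mem [MeasurableSub₂ E] [IsProbabilityMeasure P]
    (hY : IsLevyProcess Y P) {δ : ℝ≥0} {B : Set E} (hB : MeasurableSet B)
    (hne : P {ω | Y δ ω ∈ B} ≠ 0) : ∀ᵐ ω ∂P, ∃ᶠ j in atTop, gridIncr (Y · ω) δ j ∈ B := by
  have hmeas : ∀ j, MeasurableSet {ω | gridIncr (Y · ω) δ j ∈ B} := fun j ↦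
    hY.measurable_gridIncr δ j hB
  have hindep : iIndepSet (fun j ↦ {ω | gridIncr (Y · ω) δ j ∈ B}) P :=
    (iIndepSet_iff_meas_biInter hmeas).2 fun S ↦
      (hY.iIndepFun_gridIncr δ).measure_inter_preimage_eq_mul S fun _ _ ↦ hB
  have hsum : ∑' j, P {ω | gridIncr (Y · ω) δ j ∈ B} = ⊤ := by
    simp only [hY.measure_gridIncr_mem δ _ hB]
    exact ENNReal.tsum_const_eq_top_of_ne_zero hne
  filter_upwards [(mem_ae_iff_prob_eq_one (MeasurableSet.measurableSet_limsup hmeas)).2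
    (measure_limsup_eq_one hmeas hindep hsum)] with ω hω
  exact mem_limsup_iff_frequently_mem.1 hω

end Increments

lemma monotone_of_dense {f : ℝ≥0 → ℝ} (hc : ∀ s, ContinuousWithinAt f (Set.Ici s) s)
    {D : Set ℝ≥0} (hD : Dense D) (h : ∀ s ∈ D, ∀ t ∈ D, s ≤ t → f s ≤ f t) : Monotone f := by
  have hfreq : ∀ s, ∃ᶠ t in 𝓝[>] s, t ∈ D := fun s ↦ frequently_iff.2 fun {U} hU ↦ by
    obtain ⟨u, hu, hsub⟩ := mem_nhdsGT_iff_exists_Ioo_subset.1 hU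
    obtain ⟨x, hx, hxD⟩ := hD.exists_mem_open isOpen_Ioo (Set.nonempty_Ioo.2 hu)
    exact ⟨x, hsub hxD, hx⟩
  have hlim : ∀ s, Tendsto f (𝓝[>] s) (𝓝 (f s)) := fun s ↦ (hc s).mono Set.Ioi_subset_Ici_self
  intro s t hst
  refine ge_of_tendsto_of_frequently (hlim t)
    (((hfreq t).and_eventually self_mem_nhdsWithin).mono fun r ⟨hr, htr⟩ ↦ ?_)
  refine le_of_tendsto_of_frequently (hlim s) (((hfreq s).and_eventually
    (Ioo_mem_nhdsGT (hst.trans_lt htr))).mono fun q ⟨hq, hqr⟩ ↦ ?_)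
  exact h q hq r hr hqr.2.le

lemma exists_lt_of_frequently_gridIncr {f : ℝ≥0 → ℝ} (hf : Monotone f) {δ : ℝ≥0} {ε : ℝ}
    (hε : 0 < ε) (h : ∃ᶠ j in atTop, ε ≤ gridIncr f δ j) (c : ℝ) : ∃ x, c < f x := by
  by_contra! hle
  have hmono : Monotone fun j : ℕ ↦ f (j * δ) := fun i j hij ↦ hf (by gcongr)
  have hlim := tendsto_atTop_ciSup hmono ⟨c, Set.forall_mem_range.2 fun _ ↦ hle _⟩
  have hzero : Tendsto (gridIncr f δ) atTop (𝓝 0) := by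
    have := ((tendsto_add_atTop_iff_nat 1).2 hlim).sub hlim
    rwa [sub_self] at this
  obtain ⟨j, hj, hj'⟩ := (h.and_eventually (hzero.eventually_lt_const hε)).exists
  exact hj'.not_ge hj

section Subordinator

variable {X : ℝ≥0 → Ω → ℝ}

lemma IsLevyProcess.ae_monotone (hX : IsLevyProcess X P) (hnn : ∀ t, ∀ᵐ ω ∂P, 0 ≤ X t ω) :
    ∀ᵐ ω ∂P, Monotone (X · ω) := by
  obtain ⟨D, hDc, hD⟩ := TopologicalSpace.exists_countable_dense ℝ≥0
  have hle : ∀ s t, s ≤ t → ∀ᵐ ω ∂P, X s ω ≤ X t ω := fun s t hst ↦ by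
    have := (hX.stationary s (t - s)).symm.ae_mem_snd measurableSet_Ici (hnn (t - s))
    rw [add_tsub_cancel_of_le hst] at this
    exact this.mono fun ω hω ↦ sub_nonneg.1 hω
  have hD' : ∀ᵐ ω ∂P, ∀ s ∈ D, ∀ t ∈ D, s ≤ t → X s ω ≤ X t ω :=
    (ae_ball_iff hDc).2 fun s _ ↦ (ae_ball_iff hDc).2 fun t _ ↦
      eventually_imp_distrib_left.2 (hle s t)
  filter_upwards [hD'] with ω hω
  exact monotone_of_dense (fun s ↦ (hX.cadlag ω s).1) hD hω

lemma IsLevyMeasure.measure_pos_ne_zero {μ : Measure ℝ} (hμ : IsLevyMeasure μ X P)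
    (hX : IsLevyProcess X P) (hnn : ∀ t, ∀ᵐ ω ∂P, 0 ≤ X t ω) (hμ0 : μ (Set.Ioi 0) ≠ 0) :
    P {ω | 0 < X 1 ω} ≠ 0 := fun h ↦ hμ0 <| by
  rw [hμ _ measurableSet_Ioi (by simp)]
  refine lintegral_eq_zero_of_ae_eq_zero ?_
  filter_upwards [measure_eq_zero_iff_ae_notMem.1 h, hnn 0, hX.ae_monotone hnn] with ω hω h0 hmono
  have : {s : ℝ≥0 | s ∈ Set.Ioc 0 1 ∧ jump (X · ω) s ∈ Set.Ioi 0} = ∅ := by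
    refine Set.eq_empty_of_forall_notMem fun s ⟨hs, hpos⟩ ↦ hω ?_
    calc (0 : ℝ) < jump (X · ω) s := hpos
      _ ≤ X 1 ω - X 0 ω := jump_le_sub hmono hs.1 hs.2
      _ ≤ X 1 ω := sub_le_self _ h0
  simp only [this, Set.encard_empty, ENat.toENNReal_zero, Pi.zero_apply]

lemma IsLevyMeasure.ae_exists_lt [IsProbabilityMeasure P] {μ : Measure ℝ}
    (hμ : IsLevyMeasure μ X P) (hX : IsLevyProcess X P) (hnn : ∀ t, ∀ᵐ ω ∂P, 0 ≤ X t ω)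
    (hμ0 : μ (Set.Ioi 0) ≠ 0) (c : ℝ) : ∀ᵐ ω ∂P, ∃ x, c < X x ω := by
  obtain ⟨ε, hε, hne⟩ : ∃ ε > 0, P {ω | X 1 ω ∈ Set.Ici ε} ≠ 0 := by
    by_contra! h
    refine hμ.measure_pos_ne_zero hX hnn hμ0 (measure_mono_null (fun ω hω ↦ ?_)
      (measure_iUnion_null fun n : ℕ ↦ h (1 / ((n : ℝ) + 1)) Nat.one_div_pos_of_nat))
    obtain ⟨n, hn⟩ := exists_nat_one_div_lt (show 0 < X 1 ω from hω)
    exact Set.mem_iUnion.2 ⟨n, hn.le⟩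
  filter_upwards [hX.ae_frequently_gridIncr_mem measurableSet_Ici hne, hX.ae_monotone hnn]
    with ω hω hmono
  exact exists_lt_of_frequently_gridIncr hmono hε hω c

end Subordinator

end LevyProcess

/-! ### Largest jumps over grid blocks -/

/-- The largest jump of `f` over `gridBlock η i`. -/
def blockJump (f : ℝ≥0 → ℝ) (η : ℝ≥0) (i : ℕ) : ℝ := sSup (jump f '' gridBlock η i)

/-- The largest of the increments of `f` over the `n + 1` equal parts of `gridBlock η i`, a
measurable approximation of `blockJump f η i`. -/
def maxGridIncr (f : ℝ≥0 → ℝ) (η : ℝ≥0) (n i : ℕ) : ℝ :=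
  ⨆ j : Fin (n + 1), gridIncr f (η / (n + 1 : ℕ)) (i * (n + 1) + j)

section BlockJump

variable {f : ℝ≥0 → ℝ} {η s : ℝ≥0} {i : ℕ}

lemma gridBlock_div_subset {n j : ℕ} (hj : j < n + 1) :
    gridBlock (η / (n + 1 : ℕ)) (i * (n + 1) + j) ⊆ gridBlock η i := by
  have hη : ∀ k : ℕ, k * η = (k * (n + 1) : ℕ) * (η / (n + 1 : ℕ)) := fun k ↦ by
    rw [Nat.cast_mul, mul_assoc, mul_div_cancel₀ _ (by exact_mod_cast n.succ_ne_zero)]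
  rw [gridBlock, gridBlock, hη, hη]
  refine Set.Ioc_subset_Ioc ?_ ?_ <;> gcongr
  · omega
  · rw [Nat.succ_mul]
    omega

lemma exists_mem_gridBlock_div (hs : s ∈ gridBlock η i) (n : ℕ) :
    ∃ j : Fin (n + 1), s ∈ gridBlock (η / (n + 1 : ℕ)) (i * (n + 1) + j) := by
  have hη : 0 < η := pos_of_mul_pos_right (zero_le.trans_lt (hs.1.trans_le hs.2)) zero_le
  obtain ⟨m, hm⟩ := exists_mem_gridBlock (δ := η / (n + 1 : ℕ)) (by positivity)
    (zero_le.trans_lt hs.1)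
  have hm' : s ∈ gridBlock η (m / (n + 1)) := by
    refine gridBlock_div_subset (m.mod_lt n.succ_pos) ?_
    rwa [Nat.div_add_mod']
  obtain rfl := eq_of_mem_gridBlock hm' hs
  exact ⟨⟨m % (n + 1), m.mod_lt n.succ_pos⟩, by rwa [Nat.div_add_mod']⟩

lemma jump_le_maxGridIncr (hf : Monotone f) (hs : s ∈ gridBlock η i) (n : ℕ) :
    jump f s ≤ maxGridIncr f η n i := by
  obtain ⟨j, hj⟩ := exists_mem_gridBlock_div hs n
  exact (jump_le_gridIncr hf hj).trans (le_ciSup (f := fun j : Fin (n + 1) ↦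
    gridIncr f (η / (n + 1 : ℕ)) (i * (n + 1) + j)) (Set.finite_range _).bddAbove j)

lemma blockJump_nonneg (hf : Monotone f) (η : ℝ≥0) (i : ℕ) : 0 ≤ blockJump f η i :=
  Real.sSup_nonneg (Set.forall_mem_image.2 fun s _ ↦ jump_nonneg hf s)

lemma jump_le_blockJump (hf : Monotone f) (hs : s ∈ gridBlock η i) :
    jump f s ≤ blockJump f η i :=
  le_csSup ⟨_, Set.forall_mem_image.2 fun _ ht ↦ jump_le_gridIncr hf ht⟩
    (Set.mem_image_of_mem _ hs)

lemma blockJump_le_maxGridIncr (hf : Monotone f) (η : ℝ≥0) (n i : ℕ) :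
    blockJump f η i ≤ maxGridIncr f η n i :=
  Real.sSup_le (Set.forall_mem_image.2 fun _ hs ↦ jump_le_maxGridIncr hf hs n)
    (Real.iSup_nonneg fun _ ↦ gridIncr_nonneg hf _ _)

lemma exists_le_jump_of_frequently (hf : Monotone f)
    (hc : ∀ s, ContinuousWithinAt f (Set.Ici s) s) {c : ℝ} (hc0 : 0 < c)
    (h : ∃ᶠ n in atTop, c ≤ maxGridIncr f η n i) : ∃ s ∈ gridBlock η i, c ≤ jump f s := by
  obtain ⟨ψ, hψ, hψc⟩ := extraction_of_frequently_atTop h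
  choose j hj using fun m ↦ exists_eq_ciSup_of_finite
    (f := fun j : Fin (ψ m + 1) ↦ gridIncr f (η / (ψ m + 1 : ℕ)) (i * (ψ m + 1) + j))
  have hδ : Tendsto (fun m ↦ η / (ψ m + 1 : ℕ)) atTop (𝓝 0) :=
    (tendsto_const_div_atTop_nhds_zero_nat η).comp
      ((tendsto_add_atTop_nat 1).comp hψ.tendsto_atTop)
  have hle : ∀ m, c ≤ gridIncr f (η / (ψ m + 1 : ℕ)) (i * (ψ m + 1) + j m) := fun m ↦
    (hψc m).trans_eq (hj m).symm
  have hη : 0 < η := pos_iff_ne_zero.2 fun h0 ↦ (hle 0).not_gt (by simpa [gridIncr, h0])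
  obtain ⟨s, φ, -, hmem, hlim⟩ := exists_jump_of_le_gridIncr hf hc hδ hc0
    (c := (i + 1 : ℕ) * η) (fun m ↦ (gridBlock_div_subset (j m).2 (Set.right_mem_Ioc.2
      (mul_lt_mul_of_pos_right (Nat.cast_lt.2 (Nat.lt_succ_self _)) (by positivity)))).2) hle
  exact ⟨s, gridBlock_div_subset (j _).2 (hmem 0), ge_of_tendsto' hlim fun m ↦ hle (φ m)⟩

lemma exists_jump_eq_blockJump (hf : Monotone f) (hc : ∀ s, ContinuousWithinAt f (Set.Ici s) s)
    (hpos : 0 < blockJump f η i) : ∃ s ∈ gridBlock η i, jump f s = blockJump f η i := by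
  obtain ⟨s, hs, hle⟩ := exists_le_jump_of_frequently hf hc hpos
    (Frequently.of_forall fun n ↦ blockJump_le_maxGridIncr hf η n i)
  exact ⟨s, hs, (jump_le_blockJump hf hs).antisymm hle⟩

lemma blockJump_pos_iff (hf : Monotone f) (hc : ∀ s, ContinuousWithinAt f (Set.Ici s) s) :
    0 < blockJump f η i ↔ ∃ s ∈ gridBlock η i, 0 < jump f s :=
  ⟨fun h ↦ (exists_jump_eq_blockJump hf hc h).imp fun _ ⟨hs, he⟩ ↦ ⟨hs, h.trans_eq he.symm⟩,
    fun ⟨_, hs, h⟩ ↦ h.trans_le (jump_le_blockJump hf hs)⟩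

lemma blockJump_two_mul_nonpos_iff (hf : Monotone f)
    (hc : ∀ s, ContinuousWithinAt f (Set.Ici s) s) :
    blockJump f (2 * η) 0 ≤ 0 ↔ blockJump f η 0 ≤ 0 ∧ blockJump f η 1 ≤ 0 := by
  have hblock : gridBlock (2 * η) 0 = gridBlock η 0 ∪ gridBlock η 1 := by
    simp [gridBlock, one_add_one_eq_two, Set.Ioc_union_Ioc_eq_Ioc, le_mul_of_one_le_left]
  simp only [← not_lt, blockJump_pos_iff hf hc, hblock, Set.mem_union, or_and_right, exists_or,
    not_or]

lemma tendsto_maxGridIncr (hf : Monotone f) (hc : ∀ s, ContinuousWithinAt f (Set.Ici s) s)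
    (η : ℝ≥0) (i : ℕ) :
    Tendsto (fun n ↦ maxGridIncr f η n i) atTop (𝓝 (blockJump f η i)) := by
  refine tendsto_order.2 ⟨fun c h ↦ Eventually.of_forall fun n ↦
    h.trans_le (blockJump_le_maxGridIncr hf η n i), fun c h ↦ ?_⟩
  by_contra hcon
  simp only [not_eventually, not_lt] at hcon
  obtain ⟨s, hs, hle⟩ := exists_le_jump_of_frequently hf hc
    ((blockJump_nonneg hf η i).trans_lt h) hcon
  exact (hle.trans (jump_le_blockJump hf hs)).not_gt h

section Limits

variable {δ : ℕ → ℝ≥0}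

lemma eventually_gridBlock_subset (hδ : Tendsto δ atTop (𝓝 0)) {U : Set ℝ≥0} (hU : U ∈ 𝓝 s) :
    ∀ᶠ n in atTop, ∀ j, s ∈ gridBlock (δ n) j → gridBlock (δ n) j ⊆ U := by
  obtain ⟨ε, hε, hsub⟩ := Metric.mem_nhds_iff.1 hU
  have hε' : (0 : ℝ≥0) < ε.toNNReal := Real.toNNReal_pos.2 hε
  filter_upwards [hδ.eventually_lt_const hε'] with n hn j hj t ht
  refine hsub ?_
  have hn' : (δ n : ℝ) < ε := Real.lt_toNNReal_iff_coe_lt.1 hn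
  simp only [gridBlock, Set.mem_Ioc, ← NNReal.coe_lt_coe, ← NNReal.coe_le_coe, NNReal.coe_mul,
    NNReal.coe_add, NNReal.coe_natCast, Nat.cast_succ, add_one_mul] at hj ht
  rw [Metric.mem_ball, NNReal.dist_eq, abs_sub_lt_iff]
  constructor <;> linarith [hj.1, hj.2, ht.1, ht.2]

lemma eventually_blockJump_eq (hf : Monotone f) (hc : ContinuousWithinAt f (Set.Ici s) s)
    (hpos : 0 < jump f s) (hδ : Tendsto δ atTop (𝓝 0)) :
    ∀ᶠ n in atTop, ∀ j, s ∈ gridBlock (δ n) j → blockJump f (δ n) j = jump f s := by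
  have hU : {t | jump f t ≤ jump f s} ∈ 𝓝 s := by
    filter_upwards [eventually_nhdsWithin_iff.1
      ((tendsto_jump_nhdsNE hf hc).eventually_lt_const hpos)] with t ht
    rcases eq_or_ne t s with rfl | hts
    exacts [le_rfl, (ht hts).le]
  filter_upwards [eventually_gridBlock_subset hδ hU] with n hn j hj
  exact IsGreatest.csSup_eq ⟨Set.mem_image_of_mem _ hj,
    Set.forall_mem_image.2 fun t ht ↦ hn j hj ht⟩

lemma injOn_jump_of_blockJump_ne (hf : Monotone f)
    (hc : ∀ s, ContinuousWithinAt f (Set.Ici s) s) (hδ₀ : ∀ n, 0 < δ n)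
    (hδ : Tendsto δ atTop (𝓝 0))
    (h : ∀ n i j, i ≠ j → 0 < blockJump f (δ n) i → blockJump f (δ n) i ≠ blockJump f (δ n) j) :
    Set.InjOn (jump f) {s | 0 < jump f s} := by
  intro s hs t ht hst
  by_contra hne
  have hpos : ∀ {u}, 0 < jump f u → 0 < u := fun {u} hu ↦
    pos_iff_ne_zero.2 fun h0 ↦ hu.ne' (h0 ▸ jump_zero f)
  obtain ⟨n, hs', ht', hsep⟩ := ((eventually_blockJump_eq hf (hc s) hs hδ).and
    ((eventually_blockJump_eq hf (hc t) ht hδ).and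
      (eventually_gridBlock_subset hδ (isOpen_compl_singleton.mem_nhds hne)))).exists
  obtain ⟨i, hi⟩ := exists_mem_gridBlock (hδ₀ n) (hpos hs)
  obtain ⟨j, hj⟩ := exists_mem_gridBlock (hδ₀ n) (hpos ht)
  have hij : i ≠ j := fun e ↦ hsep i hi (e ▸ hj) rfl
  exact h n i j hij ((hs' i hi).symm ▸ hs) ((hs' i hi).trans (hst.trans (ht' j hj).symm))

lemma encard_le_of_forall_finset {α : Type*} {A : Set α} {b : ℝ≥0∞}
    (h : ∀ S : Finset α, (S : Set α) ⊆ A → (S.card : ℝ≥0∞) ≤ b) : (A.encard : ℝ≥0∞) ≤ b := by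
  rcases A.finite_or_infinite with hA | hA
  · rw [hA.encard_eq_coe_toFinset_card]
    exact_mod_cast h hA.toFinset hA.coe_toFinset.subset
  · suffices hb : b = ⊤ from hb ▸ le_top
    refine ENNReal.eq_top_of_forall_nnreal_le fun r ↦ ?_
    obtain ⟨n, hn⟩ := exists_nat_ge r
    obtain ⟨S, hS, rfl⟩ := hA.exists_subset_card_eq n
    exact le_trans (by exact_mod_cast hn) (h S hS)

lemma eventually_card_le_card_blockJump_pos (hf : Monotone f) {N : ℕ → ℕ}
    (hδ : Tendsto δ atTop (𝓝 0)) (hN : ∀ n, N n * δ n = 1) {S : Finset ℝ≥0}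
    (hS : ∀ s ∈ S, s ∈ Set.Ioc 0 1 ∧ 0 < jump f s) :
    ∀ᶠ n in atTop, S.card ≤ ((Finset.range (N n)).filter (0 < blockJump f (δ n) ·)).card := by
  have hsep : ∀ᶠ n in atTop, ∀ s ∈ S, ∀ j, s ∈ gridBlock (δ n) j →
      gridBlock (δ n) j ⊆ {t | t ∈ S → t = s} := by
    refine (Filter.eventually_all_finset S).2 fun s _ ↦ eventually_gridBlock_subset hδ ?_
    filter_upwards [(S.erase s).finite_toSet.isClosed.isOpen_compl.mem_nhds (by simp)]
      with t ht htS
    simpa [htS] using ht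
  filter_upwards [hsep] with n hn
  have hδn : 0 < δ n := pos_iff_ne_zero.2 fun h0 ↦ by simpa [h0] using hN n
  refine Finset.card_le_card_of_forall_subsingleton (fun s j ↦ s ∈ gridBlock (δ n) j)
    (fun s hs ↦ ?_) fun j _ s hs t ht ↦ hn t ht.1 j ht.2 hs.2 hs.1
  obtain ⟨j, hj⟩ := exists_mem_gridBlock hδn (hS s hs).1.1
  have hjN : (j : ℝ≥0) < N n :=
    lt_of_mul_lt_mul_right (hj.1.trans_le ((hS s hs).1.2.trans_eq (hN n).symm)) zero_le
  exact ⟨j, Finset.mem_filter.2 ⟨Finset.mem_range.2 (by exact_mod_cast hjN),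
    (hS s hs).2.trans_le (jump_le_blockJump hf hj)⟩, hj⟩

lemma encard_jump_pos_le_liminf (hf : Monotone f) {N : ℕ → ℕ} (hδ : Tendsto δ atTop (𝓝 0))
    (hN : ∀ n, N n * δ n = 1) :
    ({s : ℝ≥0 | s ∈ Set.Ioc 0 1 ∧ jump f s ∈ Set.Ioi 0}.encard : ℝ≥0∞) ≤
      liminf (fun n ↦ (((Finset.range (N n)).filter (0 < blockJump f (δ n) ·)).card : ℝ≥0∞))
        atTop :=
  encard_le_of_forall_finset fun _ hS ↦ le_liminf_of_le (by isBoundedDefault) <|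
    (eventually_card_le_card_blockJump_pos hf hδ hN hS).mono fun _ h ↦ by exact_mod_cast h

end Limits

end BlockJump

/-! ### Almost sure limits and independence -/

lemma ae_ne_of_indepFun {Ω E : Type*} [MeasurableSpace Ω] [MeasurableSpace E] [MeasurableEq E]
    {P : Measure Ω} [IsFiniteMeasure P] {Z W : Ω → E} (hZ : AEMeasurable Z P)
    (hW : AEMeasurable W P) (hZW : IndepFun Z W P) {A : Set E} (hA : MeasurableSet A)
    (hatom : ∀ x ∈ A, P {ω | W ω = x} = 0) : ∀ᵐ ω ∂P, Z ω ∈ A → Z ω ≠ W ω := by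
  have hD : MeasurableSet (Prod.fst ⁻¹' A ∩ Set.diagonal E) :=
    (measurable_fst hA).inter measurableSet_diagonal
  have hnull : P.map (fun ω ↦ (Z ω, W ω)) (Prod.fst ⁻¹' A ∩ Set.diagonal E) = 0 := by
    rw [hZW.map_prod_eq_prod_map_map hZ hW]
    refine Measure.measure_prod_null_of_ae_null hD (Eventually.of_forall fun x ↦ ?_)
    by_cases hx : x ∈ A
    · refine measure_mono_null (t := {x}) (fun y hy ↦ hy.2.symm) ?_
      rw [Measure.map_apply_of_aemeasurable hW (measurableSet_singleton x)]
      exact hatom x hx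
    · exact measure_mono_null (t := ∅) (fun y hy ↦ hx hy.1) measure_empty
  rw [Measure.map_apply_of_aemeasurable (hZ.prodMk hW) hD] at hnull
  filter_upwards [measure_eq_zero_iff_ae_notMem.1 hnull] with ω hω hA heq
  exact hω ⟨hA, heq⟩

section AeLimit

variable {Ω E F : Type*} [MeasurableSpace Ω] {P : Measure Ω}
  [TopologicalSpace E] [MeasurableSpace E] [BorelSpace E]
  [TopologicalSpace F] [MeasurableSpace F] [BorelSpace F]
  {X X' : ℕ → Ω → E} {Z Z' : Ω → E}

lemma tendsto_integral_of_tendsto_ae [IsFiniteMeasure P] (hX : ∀ n, AEMeasurable (X n) P)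
    (h : ∀ᵐ ω ∂P, Tendsto (X · ω) atTop (𝓝 (Z ω))) (f : BoundedContinuousFunction E ℝ) :
    Tendsto (fun n ↦ ∫ ω, f (X n ω) ∂P) atTop (𝓝 (∫ ω, f (Z ω) ∂P)) :=
  tendsto_integral_of_dominated_convergence (fun _ ↦ ‖f‖)
    (fun n ↦ (f.continuous.measurable.comp_aemeasurable (hX n)).aestronglyMeasurable)
    (integrable_const _) (fun _ ↦ Eventually.of_forall fun _ ↦ f.norm_coe_le_norm _)
    (h.mono fun _ hω ↦ (f.continuous.tendsto _).comp hω)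

variable [TopologicalSpace.PseudoMetrizableSpace E] [TopologicalSpace.PseudoMetrizableSpace F]

lemma identDistrib_of_tendsto_ae [IsFiniteMeasure P] (hX : ∀ n, IdentDistrib (X n) (X' n) P P)
    (h : ∀ᵐ ω ∂P, Tendsto (X · ω) atTop (𝓝 (Z ω)))
    (h' : ∀ᵐ ω ∂P, Tendsto (X' · ω) atTop (𝓝 (Z' ω))) : IdentDistrib Z Z' P P where
  aemeasurable_fst := aemeasurable_of_tendsto_metrizable_ae' (fun n ↦ (hX n).aemeasurable_fst) h
  aemeasurable_snd := aemeasurable_of_tendsto_metrizable_ae' (fun n ↦ (hX n).aemeasurable_snd) h'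
  map_eq := by
    have hm : ∀ n, AEMeasurable (X n) P := fun n ↦ (hX n).aemeasurable_fst
    have hm' : ∀ n, AEMeasurable (X' n) P := fun n ↦ (hX n).aemeasurable_snd
    refine ext_of_forall_integral_eq_of_IsFiniteMeasure fun f ↦ ?_
    have hf : Measurable f := f.continuous.measurable
    rw [integral_map (aemeasurable_of_tendsto_metrizable_ae' hm h) hf.aestronglyMeasurable,
      integral_map (aemeasurable_of_tendsto_metrizable_ae' hm' h') hf.aestronglyMeasurable]
    refine tendsto_nhds_unique (tendsto_integral_of_tendsto_ae hm h f)
      ((tendsto_congr fun n ↦ ?_).2 (tendsto_integral_of_tendsto_ae hm' h' f))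
    exact ((hX n).comp hf).integral_eq

lemma indepFun_of_tendsto_ae [IsFiniteMeasure P] {Y : ℕ → Ω → F} {W : Ω → F}
    (hX : ∀ n, AEMeasurable (X n) P) (hY : ∀ n, AEMeasurable (Y n) P)
    (hXY : ∀ n, IndepFun (X n) (Y n) P) (h : ∀ᵐ ω ∂P, Tendsto (X · ω) atTop (𝓝 (Z ω)))
    (h' : ∀ᵐ ω ∂P, Tendsto (Y · ω) atTop (𝓝 (W ω))) : IndepFun Z W P := by
  refine indepFun_of_bcf (aemeasurable_of_tendsto_metrizable_ae' hX h)
    (aemeasurable_of_tendsto_metrizable_ae' hY h') fun f g ↦ ?_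
  have hf : Measurable f := f.continuous.measurable
  have hg : Measurable g := g.continuous.measurable
  have hprod : ∀ n, ∫ ω, f (X n ω) * g (Y n ω) ∂P = (∫ ω, f (X n ω) ∂P) * ∫ ω, g (Y n ω) ∂P :=
    fun n ↦ ((hXY n).comp hf hg).integral_mul_eq_mul_integral
      (hf.comp_aemeasurable (hX n)).aestronglyMeasurable
      (hg.comp_aemeasurable (hY n)).aestronglyMeasurable
  have hlim := (tendsto_integral_of_tendsto_ae hX h f).mul (tendsto_integral_of_tendsto_ae hY h' g)
  simp only [← hprod] at hlim
  refine tendsto_nhds_unique ?_ hlim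
  refine tendsto_integral_of_dominated_convergence (fun _ ↦ ‖f‖ * ‖g‖)
    (fun n ↦ ((hf.comp_aemeasurable (hX n)).mul
      (hg.comp_aemeasurable (hY n))).aestronglyMeasurable)
    (integrable_const _) (fun _ ↦ Eventually.of_forall fun _ ↦ ?_) ?_
  · rw [norm_mul]
    gcongr <;> exact BoundedContinuousFunction.norm_coe_le_norm _ _
  · filter_upwards [h, h'] with ω hω hω'
    exact ((f.continuous.tendsto _).comp hω).mul ((g.continuous.tendsto _).comp hω')

end AeLimit

/-! ### The jumps of a subordinator -/

section BlockJumpLaw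

variable {Ω : Type*} [MeasurableSpace Ω] {P : Measure Ω} {X : ℝ≥0 → Ω → ℝ}

lemma IsLevyProcess.measurable_maxGridIncr (hX : IsLevyProcess X P) (η : ℝ≥0) (n i : ℕ) :
    Measurable fun ω ↦ maxGridIncr (X · ω) η n i :=
  Measurable.iSup fun _ ↦ hX.measurable_gridIncr _ _

lemma IsLevyProcess.identDistrib_maxGridIncr (hX : IsLevyProcess X P) (η : ℝ≥0) (n i j : ℕ) :
    IdentDistrib (fun ω ↦ maxGridIncr (X · ω) η n i) (fun ω ↦ maxGridIncr (X · ω) η n j) P P := by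
  have hindep : ∀ i : ℕ, iIndepFun (fun (l : Fin (n + 1)) ω ↦
      gridIncr (X · ω) (η / (n + 1 : ℕ)) (i * (n + 1) + l)) P := fun i ↦
    (hX.iIndepFun_gridIncr _).precomp fun l l' h ↦ Fin.ext (Nat.add_left_cancel h)
  exact (IdentDistrib.pi (fun l ↦ (hX.identDistrib_gridIncr _ _).trans
    (hX.identDistrib_gridIncr _ _).symm) (hindep i) (hindep j)).comp
    (u := fun d : Fin (n + 1) → ℝ ↦ ⨆ l, d l) (Measurable.iSup measurable_pi_apply)

lemma IsLevyProcess.indepFun_maxGridIncr (hX : IsLevyProcess X P) (η : ℝ≥0) (n : ℕ) {i j : ℕ}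
    (hij : i ≠ j) :
    IndepFun (fun ω ↦ maxGridIncr (X · ω) η n i) (fun ω ↦ maxGridIncr (X · ω) η n j) P := by
  let S : ℕ → Finset ℕ := fun i ↦ Finset.univ.image fun l : Fin (n + 1) ↦ i * (n + 1) + l
  have hS : ∀ i, ∀ m ∈ S i, m / (n + 1) = i := fun i ↦ Finset.forall_mem_image.2 fun l _ ↦ by
    rw [mul_comm, Nat.mul_add_div n.succ_pos, Nat.div_eq_of_lt l.2, add_zero]
  have hu : ∀ i, Measurable fun d : S i → ℝ ↦ ⨆ l : Fin (n + 1),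
      d ⟨i * (n + 1) + l, Finset.mem_image_of_mem _ (Finset.mem_univ l)⟩ := fun i ↦
    Measurable.iSup fun _ ↦ measurable_pi_apply _
  exact ((hX.iIndepFun_gridIncr _).indepFun_finset (S i) (S j)
    (Finset.disjoint_left.2 fun m hi hj ↦ hij ((hS i m hi).symm.trans (hS j m hj)))
    (hX.measurable_gridIncr _)).comp (hu i) (hu j)

lemma IsLevyProcess.ae_tendsto_maxGridIncr (hX : IsLevyProcess X P)
    (hmono : ∀ᵐ ω ∂P, Monotone (X · ω)) (η : ℝ≥0) (i : ℕ) :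
    ∀ᵐ ω ∂P, Tendsto (fun n ↦ maxGridIncr (X · ω) η n i) atTop (𝓝 (blockJump (X · ω) η i)) :=
  hmono.mono fun ω h ↦ tendsto_maxGridIncr h (fun s ↦ (hX.cadlag ω s).1) η i

lemma IsLevyProcess.aemeasurable_blockJump (hX : IsLevyProcess X P)
    (hmono : ∀ᵐ ω ∂P, Monotone (X · ω)) (η : ℝ≥0) (i : ℕ) :
    AEMeasurable (fun ω ↦ blockJump (X · ω) η i) P :=
  aemeasurable_of_tendsto_metrizable_ae' (fun n ↦ (hX.measurable_maxGridIncr η n i).aemeasurable)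
    (hX.ae_tendsto_maxGridIncr hmono η i)

lemma IsLevyProcess.nullMeasurableSet_blockJump_pos (hX : IsLevyProcess X P)
    (hmono : ∀ᵐ ω ∂P, Monotone (X · ω)) (η : ℝ≥0) (i : ℕ) :
    NullMeasurableSet {ω | 0 < blockJump (X · ω) η i} P :=
  (hX.aemeasurable_blockJump hmono η i).nullMeasurableSet_preimage measurableSet_Ioi

section FiniteMeasure

variable [IsFiniteMeasure P]

lemma IsLevyProcess.identDistrib_blockJump (hX : IsLevyProcess X P)
    (hmono : ∀ᵐ ω ∂P, Monotone (X · ω)) (η : ℝ≥0) (i j : ℕ) :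
    IdentDistrib (fun ω ↦ blockJump (X · ω) η i) (fun ω ↦ blockJump (X · ω) η j) P P :=
  identDistrib_of_tendsto_ae (fun n ↦ hX.identDistrib_maxGridIncr η n i j)
    (hX.ae_tendsto_maxGridIncr hmono η i) (hX.ae_tendsto_maxGridIncr hmono η j)

lemma IsLevyProcess.indepFun_blockJump (hX : IsLevyProcess X P)
    (hmono : ∀ᵐ ω ∂P, Monotone (X · ω)) (η : ℝ≥0) {i j : ℕ} (hij : i ≠ j) :
    IndepFun (fun ω ↦ blockJump (X · ω) η i) (fun ω ↦ blockJump (X · ω) η j) P :=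
  indepFun_of_tendsto_ae (fun n ↦ (hX.measurable_maxGridIncr η n i).aemeasurable)
    (fun n ↦ (hX.measurable_maxGridIncr η n j).aemeasurable)
    (fun n ↦ hX.indepFun_maxGridIncr η n hij)
    (hX.ae_tendsto_maxGridIncr hmono η i) (hX.ae_tendsto_maxGridIncr hmono η j)

lemma IsLevyMeasure.measure_blockJump_eq_zero {μ : Measure ℝ} (hμ : IsLevyMeasure μ X P)
    (hX : IsLevyProcess X P) (hmono : ∀ᵐ ω ∂P, Monotone (X · ω)) {x : ℝ} (hx : 0 < x)
    (hμx : μ {x} = 0) {η : ℝ≥0} (hη : η ≤ 1) (i : ℕ) :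
    P {ω | blockJump (X · ω) η i = x} = 0 := by
  have hset : P {ω | blockJump (X · ω) η i = x} = P {ω | blockJump (X · ω) η 0 = x} :=
    (hX.identDistrib_blockJump hmono η i 0).measure_mem_eq (measurableSet_singleton x)
  have hnull : NullMeasurableSet {ω | blockJump (X · ω) η 0 = x} P :=
    (hX.aemeasurable_blockJump hmono η 0).nullMeasurableSet_preimage
      (measurableSet_singleton x)
  rw [hset, ← nonpos_iff_eq_zero, ← hμx, hμ _ (measurableSet_singleton x) hx.ne,
    ← lintegral_indicator_one₀ hnull]
  refine lintegral_mono_ae (hmono.mono fun ω hω ↦ Set.indicator_apply_le' (fun h ↦ ?_)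
    fun _ ↦ zero_le)
  replace h : blockJump (X · ω) η 0 = x := h
  obtain ⟨s, hs, hsx⟩ := exists_jump_eq_blockJump hω (fun s ↦ (hX.cadlag ω s).1) (h ▸ hx)
  have hs1 : s ∈ Set.Ioc 0 1 :=
    ⟨zero_le.trans_lt hs.1, hs.2.trans (by simpa using hη)⟩
  have hne : {s | s ∈ Set.Ioc 0 1 ∧ jump (X · ω) s ∈ ({x} : Set ℝ)}.Nonempty :=
    ⟨s, hs1, hsx.trans h⟩
  rw [Pi.one_apply]
  exact_mod_cast Set.one_le_encard_iff_nonempty.2 hne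

lemma IsLevyMeasure.ae_injOn_jump {μ : Measure ℝ} (hμ : IsLevyMeasure μ X P)
    (hX : IsLevyProcess X P) (hmono : ∀ᵐ ω ∂P, Monotone (X · ω)) (hμ0 : ∀ x > 0, μ {x} = 0) :
    ∀ᵐ ω ∂P, Set.InjOn (jump (X · ω)) {s | 0 < jump (X · ω) s} := by
  have hne : ∀ n i j : ℕ, ∀ᵐ ω ∂P, i ≠ j →
      0 < blockJump (X · ω) (1 / ((n : ℝ≥0) + 1)) i →
      blockJump (X · ω) (1 / ((n : ℝ≥0) + 1)) i ≠ blockJump (X · ω) (1 / ((n : ℝ≥0) + 1)) j :=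
    fun n i j ↦ eventually_imp_distrib_left.2 fun hij ↦
      ae_ne_of_indepFun (hX.aemeasurable_blockJump hmono _ _) (hX.aemeasurable_blockJump hmono _ _)
        (hX.indepFun_blockJump hmono _ hij) measurableSet_Ioi
        fun x hx ↦ hμ.measure_blockJump_eq_zero hX hmono hx (hμ0 x hx)
          (div_le_one_of_le₀ (by simp) zero_le) j
  filter_upwards [hmono, ae_all_iff.2 fun n ↦ ae_all_iff.2 fun i ↦ ae_all_iff.2 (hne n i)]
    with ω hω hω'
  exact injOn_jump_of_blockJump_ne hω (fun s ↦ (hX.cadlag ω s).1)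
    (δ := fun n ↦ 1 / ((n : ℝ≥0) + 1)) (fun n ↦ by positivity)
    tendsto_one_div_add_atTop_nhds_zero_nat hω'

lemma IsLevyProcess.measureReal_blockJump_two_mul (hX : IsLevyProcess X P)
    (hmono : ∀ᵐ ω ∂P, Monotone (X · ω)) (η : ℝ≥0) :
    P.real {ω | blockJump (X · ω) (2 * η) 0 ≤ 0} = P.real {ω | blockJump (X · ω) η 0 ≤ 0} ^ 2 := by
  have hsplit : {ω | blockJump (X · ω) (2 * η) 0 ≤ 0} =ᵐ[P]
      ({ω | blockJump (X · ω) η 0 ≤ 0} ∩ {ω | blockJump (X · ω) η 1 ≤ 0} : Set Ω) :=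
    hmono.mono fun ω hω ↦ propext
      (blockJump_two_mul_nonpos_iff hω (fun s ↦ (hX.cadlag ω s).1))
  have hindep := (hX.indepFun_blockJump hmono η zero_ne_one).measure_inter_preimage_eq_mul
    (Set.Iic 0) (Set.Iic 0) measurableSet_Iic measurableSet_Iic
  rw [(hX.identDistrib_blockJump hmono η 1 0).measure_mem_eq measurableSet_Iic] at hindep
  rw [sq, measureReal_congr hsplit, measureReal_def, measureReal_def, ← ENNReal.toReal_mul]
  exact congr_arg _ hindep

lemma IsLevyProcess.measureReal_blockJump_pow (hX : IsLevyProcess X P)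
    (hmono : ∀ᵐ ω ∂P, Monotone (X · ω)) (n : ℕ) :
    P.real {ω | blockJump (X · ω) (1 / 2 ^ n) 0 ≤ 0} ^ 2 ^ n =
      P.real {ω | blockJump (X · ω) 1 0 ≤ 0} := by
  induction n with
  | zero => simp
  | succ n ih =>
    have h2 : (1 / 2 ^ n : ℝ≥0) = 2 * (1 / 2 ^ (n + 1)) := by
      rw [pow_succ']
      field_simp
    rw [← ih, h2, hX.measureReal_blockJump_two_mul hmono, ← pow_mul, ← pow_succ']

lemma IsLevyProcess.lintegral_card_blockJump_pos (hX : IsLevyProcess X P)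
    (hmono : ∀ᵐ ω ∂P, Monotone (X · ω)) (η : ℝ≥0) (N : ℕ) :
    ∫⁻ ω, (((Finset.range N).filter (0 < blockJump (X · ω) η ·)).card : ℝ≥0∞) ∂P =
      N * P {ω | 0 < blockJump (X · ω) η 0} := by
  have hident : ∀ i, P {ω | 0 < blockJump (X · ω) η i} = P {ω | 0 < blockJump (X · ω) η 0} :=
    fun i ↦ (hX.identDistrib_blockJump hmono η i 0).measure_mem_eq measurableSet_Ioi
  calc ∫⁻ ω, (((Finset.range N).filter (0 < blockJump (X · ω) η ·)).card : ℝ≥0∞) ∂P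
      = ∫⁻ ω, ∑ i ∈ Finset.range N, {ω | 0 < blockJump (X · ω) η i}.indicator 1 ω ∂P := by
        simp [Set.indicator_apply]
    _ = ∑ i ∈ Finset.range N, P {ω | 0 < blockJump (X · ω) η i} := by
        refine (lintegral_finsetSum' _ fun i _ ↦
          aemeasurable_one.indicator₀ (hX.nullMeasurableSet_blockJump_pos hmono η i)).trans ?_
        exact Finset.sum_congr rfl fun i _ ↦
          lintegral_indicator_one₀ (hX.nullMeasurableSet_blockJump_pos hmono η i)
    _ = N * P {ω | 0 < blockJump (X · ω) η 0} := by simp [hident]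

lemma IsLevyMeasure.measure_pos_le_liminf {μ : Measure ℝ} (hμ : IsLevyMeasure μ X P)
    (hX : IsLevyProcess X P) (hmono : ∀ᵐ ω ∂P, Monotone (X · ω)) :
    μ (Set.Ioi 0) ≤
      liminf (fun n : ℕ ↦ 2 ^ n * P {ω | 0 < blockJump (X · ω) (1 / 2 ^ n) 0}) atTop := by
  have hδ : Tendsto (fun n : ℕ ↦ (1 / 2 ^ n : ℝ≥0)) atTop (𝓝 0) := by
    simpa using tendsto_pow_atTop_nhds_zero_of_lt_one (r := (1 / 2 : ℝ≥0)) zero_le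
      (NNReal.half_lt_self one_ne_zero)
  calc μ (Set.Ioi 0)
      ≤ ∫⁻ ω, liminf (fun n : ℕ ↦ (((Finset.range (2 ^ n)).filter
          (0 < blockJump (X · ω) (1 / 2 ^ n) ·)).card : ℝ≥0∞)) atTop ∂P := by
        rw [hμ _ measurableSet_Ioi Set.self_notMem_Ioi]
        exact lintegral_mono_ae
          (hmono.mono fun ω hω ↦ encard_jump_pos_le_liminf hω hδ fun n ↦ by simp)
    _ ≤ liminf (fun n : ℕ ↦ ∫⁻ ω, (((Finset.range (2 ^ n)).filter
          (0 < blockJump (X · ω) (1 / 2 ^ n) ·)).card : ℝ≥0∞) ∂P) atTop := by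
        refine lintegral_liminf_le' fun n ↦ ?_
        simp only [Finset.card_filter, Nat.cast_sum, Nat.cast_ite, Nat.cast_one, Nat.cast_zero]
        exact Finset.aemeasurable_fun_sum _ fun i _ ↦
          aemeasurable_one.indicator₀ (hX.nullMeasurableSet_blockJump_pos hmono _ i)
    _ = liminf (fun n : ℕ ↦ 2 ^ n * P {ω | 0 < blockJump (X · ω) (1 / 2 ^ n) 0}) atTop := by
        simp [hX.lintegral_card_blockJump_pos hmono]

end FiniteMeasure

lemma IsLevyProcess.two_pow_mul_measure_blockJump_pos_le [IsProbabilityMeasure P]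
    (hX : IsLevyProcess X P) (hmono : ∀ᵐ ω ∂P, Monotone (X · ω))
    (hne : P.real {ω | blockJump (X · ω) 1 0 ≤ 0} ≠ 0) (n : ℕ) :
    2 ^ n * P {ω | 0 < blockJump (X · ω) (1 / 2 ^ n) 0} ≤
      ENNReal.ofReal (-Real.log (P.real {ω | blockJump (X · ω) 1 0 ≤ 0})) := by
  have hpos : 0 < P.real {ω | blockJump (X · ω) (1 / 2 ^ n) 0 ≤ 0} :=
    measureReal_nonneg.lt_of_ne' fun h ↦ hne <| by
      rw [← hX.measureReal_blockJump_pow hmono n, h, zero_pow (pow_ne_zero n two_ne_zero)]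
  have hcompl := probReal_compl_eq_one_sub₀ (hX.nullMeasurableSet_blockJump_pos hmono (1 / 2 ^ n) 0)
  simp only [Set.compl_ofPred, not_lt] at hcompl
  rw [← hX.measureReal_blockJump_pow hmono n, Real.log_pow, ← ofReal_measureReal,
    ← ENNReal.ofReal_ofNat, ← ENNReal.ofReal_pow zero_le_two,
    ← ENNReal.ofReal_mul (by positivity), ← mul_neg]
  push_cast
  gcongr
  linarith [Real.log_le_sub_one_of_pos hpos]

lemma IsLevyMeasure.measureReal_blockJump_eq_zero [IsProbabilityMeasure P] {μ : Measure ℝ}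
    (hμ : IsLevyMeasure μ X P) (hX : IsLevyProcess X P) (hmono : ∀ᵐ ω ∂P, Monotone (X · ω))
    (hμtop : μ (Set.Ioi 0) = ⊤) (n : ℕ) :
    P.real {ω | blockJump (X · ω) (1 / 2 ^ n) 0 ≤ 0} = 0 := by
  by_contra hne
  rw [← pow_eq_zero_iff (pow_ne_zero n two_ne_zero), hX.measureReal_blockJump_pow hmono] at hne
  refine (hμ.measure_pos_le_liminf hX hmono).not_gt (hμtop ▸ lt_of_le_of_lt ?_
    (ENNReal.ofReal_lt_top (r := -Real.log (P.real {ω | blockJump (X · ω) 1 0 ≤ 0}))))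
  exact liminf_le_of_le (by isBoundedDefault) fun b hb ↦ (hb.exists.elim fun n hn ↦ hn.trans
    (hX.two_pow_mul_measure_blockJump_pos_le hmono hne n))

lemma IsLevyMeasure.ae_exists_jump_pos [IsProbabilityMeasure P] {μ : Measure ℝ}
    (hμ : IsLevyMeasure μ X P) (hX : IsLevyProcess X P) (hmono : ∀ᵐ ω ∂P, Monotone (X · ω))
    (hμtop : μ (Set.Ioi 0) = ⊤) :
    ∀ᵐ ω ∂P, ∀ ε > 0, ∃ s ∈ Set.Ioo 0 ε, 0 < jump (X · ω) s := by
  have hpos : ∀ᵐ ω ∂P, ∀ n : ℕ, 0 < blockJump (X · ω) (1 / 2 ^ n) 0 := ae_all_iff.2 fun n ↦ by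
    simpa [ae_iff] using (measureReal_eq_zero_iff (by finiteness)).1
      (hμ.measureReal_blockJump_eq_zero hX hmono hμtop n)
  filter_upwards [hmono, hpos] with ω hω hω' ε hε
  obtain ⟨n, hn⟩ := NNReal.exists_pow_lt_of_lt_one hε (NNReal.half_lt_self one_ne_zero)
  obtain ⟨s, hs, hjump⟩ := (blockJump_pos_iff hω fun s ↦ (hX.cadlag ω s).1).1 (hω' n)
  rw [one_div_pow] at hn
  exact ⟨s, ⟨by simpa using hs.1, lt_of_le_of_lt (by simpa [gridBlock] using hs.2) hn⟩, hjump⟩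

end BlockJumpLaw

/-! ### The first marginal of the Lévy measure -/

section ExpFunctional

variable {Ω : Type*} [MeasurableSpace Ω]

lemma measurable_lintegral_exp_neg {W : ℝ≥0 → Ω → ℝ} (hm : ∀ t, Measurable (W t))
    (hc : ∀ ω, Continuous (W · ω)) :
    Measurable fun ω ↦ ∫⁻ x in Set.Ioi (0 : ℝ), ENNReal.ofReal (Real.exp (-W x.toNNReal ω)) := by
  have hmeas : Measurable fun p : Ω × ℝ ↦ W p.2.toNNReal p.1 :=
    (measurable_uncurry_of_continuous_of_measurable (u := W) hc hm).comp
      ((measurable_real_toNNReal.comp measurable_snd).prodMk measurable_fst)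
  exact hmeas.neg.exp.ennreal_ofReal.lintegral_prod_right'

lemma measurable_expFunctional {W W' : ℝ≥0 → Ω → ℝ} (hW : ∀ t, Measurable (W t))
    (hWc : ∀ ω, Continuous (W · ω)) (hW' : ∀ t, Measurable (W' t))
    (hWc' : ∀ ω, Continuous (W' · ω)) : Measurable (expFunctional W W') :=
  (measurable_lintegral_exp_neg hW hWc).add (measurable_lintegral_exp_neg hW' hWc')

end ExpFunctional

lemma expFunctional_pos {Ω : Type*} {W W' : ℝ≥0 → Ω → ℝ} {ω : Ω} (hW : Continuous (W · ω)) :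
    0 < expFunctional W W' ω := by
  have hm : Measurable fun x : ℝ ↦ ENNReal.ofReal (Real.exp (-W x.toNNReal ω)) := by
    have : Continuous fun x : ℝ ↦ W x.toNNReal ω := hW.comp continuous_real_toNNReal
    fun_prop
  have hsupp : Function.support (fun x : ℝ ↦ ENNReal.ofReal (Real.exp (-W x.toNNReal ω))) =
      Set.univ := by
    ext x
    simp [Real.exp_pos]
  refine add_pos_of_pos_of_nonneg ?_ zero_le
  rw [lintegral_pos_iff_support hm, hsupp]
  simp

lemma tendsto_measure_lt {Ω : Type*} [MeasurableSpace Ω] {P : Measure Ω} {R : Ω → ℝ≥0∞}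
    (hR0 : ∀ ω, 0 < R ω) {a : ℕ → ℝ≥0∞} (ha : Antitone a) (hlim : Tendsto a atTop (𝓝 0)) :
    Tendsto (fun n ↦ P {ω | a n < R ω}) atTop (𝓝 (P Set.univ)) := by
  have hunion : ⋃ n, {ω | a n < R ω} = Set.univ := Set.eq_univ_of_forall fun ω ↦
    Set.mem_iUnion.2 (hlim.eventually_lt_const (hR0 ω)).exists
  rw [← hunion]
  exact tendsto_measure_iUnion_atTop fun m n hmn ω hω ↦ (ha hmn).trans_lt hω

namespace IsStableMeasure

variable {Ω : Type*} [MeasurableSpace Ω] {P : Measure Ω} {R : Ω → ℝ≥0∞} {κ C : ℝ}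
  {ν : Measure (ℝ × ℝ)} {x : ℝ}

lemma ae_snd_pos (hν : IsStableMeasure κ C R P ν) : ∀ᵐ p ∂ν, 0 < p.2 := by
  have h : ∀ᵐ p ∂ν, p ∈ Set.Ioi (0 : ℝ) ×ˢ Set.Ioi (0 : ℝ) := mem_ae_iff.2 hν.compl
  exact h.mono fun _ hp ↦ hp.2

lemma tendsto_measure_Ici_prod_Ici (hν : IsStableMeasure κ C R P ν) {y : ℕ → ℝ} (hy : Antitone y)
    (hy0 : ∀ n, 0 < y n) (hlim : Tendsto y atTop (𝓝 0)) (x : ℝ) :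
    Tendsto (fun n ↦ ν (Set.Ici x ×ˢ Set.Ici (y n))) atTop (𝓝 (ν (Set.Ici x ×ˢ Set.univ))) := by
  have hunion : ν (Set.Ici x ×ˢ Set.univ) = ν (⋃ n, Set.Ici x ×ˢ Set.Ici (y n)) := by
    rw [← Set.prod_iUnion, iUnion_Ici_eq_Ioi_of_lt_of_tendsto hy0 hlim]
    refine measure_congr ?_
    filter_upwards [hν.ae_snd_pos] with p hp
    exact propext (and_congr_right fun _ ↦ iff_of_true trivial hp)
  rw [hunion]
  exact tendsto_measure_iUnion_atTop fun m n hmn ↦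
    Set.prod_mono le_rfl (Set.Ici_subset_Ici.2 (hy hmn))

variable [IsProbabilityMeasure P]

lemma measure_Ici_prod_Ici_le (hν : IsStableMeasure κ C R P ν) (hR : Measurable R) (hκ : 0 ≤ κ)
    (hC : 0 ≤ C) (hx : 0 < x) {y : ℝ} (hy : 0 < y) :
    ν (Set.Ici x ×ˢ Set.Ici y) ≤ ENNReal.ofReal (C / x ^ κ) := by
  set A : Set Ω := {ω | R ω ≤ ENNReal.ofReal (y / x)} with hA
  have hAm : MeasurableSet A := measurableSet_le hR measurable_const
  have hcompl : {ω | ENNReal.ofReal (y / x) < R ω} = Aᶜ := by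
    ext
    simp [hA]
  have hscale : ENNReal.ofReal (C / y ^ κ) * ENNReal.ofReal (y / x) ^ κ =
      ENNReal.ofReal (C / x ^ κ) := by
    have := Real.rpow_pos_of_pos hy κ
    rw [ENNReal.ofReal_rpow_of_pos (div_pos hy hx), ← ENNReal.ofReal_mul (by positivity),
      Real.div_rpow hy.le hx.le]
    congr 1
    field_simp
  rw [hν.quadrant x y hx hy, hcompl]
  calc ENNReal.ofReal (C / y ^ κ) * (∫⁻ ω in A, R ω ^ κ ∂P) + ENNReal.ofReal (C / x ^ κ) * P Aᶜ
      ≤ ENNReal.ofReal (C / y ^ κ) * (∫⁻ _ in A, ENNReal.ofReal (y / x) ^ κ ∂P) +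
          ENNReal.ofReal (C / x ^ κ) * P Aᶜ := by
        gcongr _ * ?_ + _
        exact setLIntegral_mono' hAm fun ω hω ↦ ENNReal.rpow_le_rpow hω hκ
    _ = ENNReal.ofReal (C / x ^ κ) * (P A + P Aᶜ) := by
        rw [setLIntegral_const, ← mul_assoc, hscale, mul_add]
    _ = ENNReal.ofReal (C / x ^ κ) := by
        rw [measure_add_measure_compl hAm, measure_univ, mul_one]

lemma measure_Ici_prod_univ (hν : IsStableMeasure κ C R P ν) (hR : Measurable R)
    (hR0 : ∀ ω, 0 < R ω) (hκ : 0 ≤ κ) (hC : 0 ≤ C) (hx : 0 < x) :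
    ν (Set.Ici x ×ˢ Set.univ) = ENNReal.ofReal (C / x ^ κ) := by
  have hy : Antitone fun n : ℕ ↦ 1 / ((n : ℝ) + 1) := fun m n hmn ↦
    one_div_le_one_div_of_le (by positivity) (by gcongr)
  have hy0 : ∀ n : ℕ, 0 < 1 / ((n : ℝ) + 1) := fun n ↦ by positivity
  have hlim := hν.tendsto_measure_Ici_prod_Ici hy hy0 tendsto_one_div_add_atTop_nhds_zero_nat x
  have hP : Tendsto (fun n : ℕ ↦ P {ω | ENNReal.ofReal (1 / ((n : ℝ) + 1) / x) < R ω}) atTop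
      (𝓝 1) := by
    rw [← measure_univ (μ := P)]
    refine tendsto_measure_lt hR0 (fun m n hmn ↦ ENNReal.ofReal_le_ofReal
      (div_le_div_of_nonneg_right (hy hmn) hx.le)) ?_
    simpa using ENNReal.tendsto_ofReal (tendsto_one_div_add_atTop_nhds_zero_nat.div_const x)
  refine le_antisymm (le_of_tendsto' hlim fun n ↦
    hν.measure_Ici_prod_Ici_le hR hκ hC hx (hy0 n)) ?_
  refine le_of_tendsto_of_tendsto' (f := fun n : ℕ ↦ ENNReal.ofReal (C / x ^ κ) *
    P {ω | ENNReal.ofReal (1 / ((n : ℝ) + 1) / x) < R ω}) ?_ hlim fun n ↦ ?_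
  · simpa using ENNReal.Tendsto.const_mul hP (Or.inr ENNReal.ofReal_ne_top)
  · exact le_add_self.trans_eq (hν.quadrant x _ hx (hy0 n)).symm

lemma measure_Ioi_prod_univ (hν : IsStableMeasure κ C R P ν) (hR : Measurable R)
    (hR0 : ∀ ω, 0 < R ω) (hκ : 0 < κ) (hC : 0 < C) : ν (Set.Ioi 0 ×ˢ Set.univ) = ⊤ := by
  have hlim : Tendsto (fun x : ℝ ↦ ENNReal.ofReal (C / x ^ κ)) (𝓝[>] 0) (𝓝 ⊤) := by
    refine ENNReal.tendsto_ofReal_atTop.comp (((tendsto_rpow_neg_nhdsGT_zero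
      (neg_neg_of_pos hκ)).const_mul_atTop hC).congr' ?_)
    filter_upwards [self_mem_nhdsWithin] with x hx
    rw [Real.rpow_neg (le_of_lt hx), div_eq_mul_inv]
  refine top_le_iff.1 (le_of_tendsto hlim ?_)
  filter_upwards [self_mem_nhdsWithin] with x hx
  rw [← hν.measure_Ici_prod_univ hR hR0 hκ.le hC.le hx]
  exact measure_mono (Set.prod_mono (Set.Ici_subset_Ioi.2 hx) le_rfl)

lemma measure_singleton_prod_univ (hν : IsStableMeasure κ C R P ν) (hR : Measurable R)
    (hR0 : ∀ ω, 0 < R ω) (hκ : 0 ≤ κ) (hC : 0 ≤ C) (hx : 0 < x) :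
    ν ({x} ×ˢ Set.univ) = 0 := by
  have htail : ∀ {y : ℝ}, 0 < y → ν (Set.Ici y ×ˢ Set.univ) = ENNReal.ofReal (C / y ^ κ) :=
    hν.measure_Ici_prod_univ hR hR0 hκ hC
  have hsum : ∀ y > x, ν ({x} ×ˢ Set.univ) + ENNReal.ofReal (C / y ^ κ) ≤
      ENNReal.ofReal (C / x ^ κ) := fun y hy ↦ by
    rw [← htail hx, ← htail (hx.trans hy), ← measure_union
      (Set.disjoint_left.2 fun p hp hp' ↦ hy.not_ge (hp'.1.trans_eq hp.1))
      (measurableSet_Ici.prod MeasurableSet.univ), ← Set.union_prod]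
    exact measure_mono (Set.prod_mono (Set.union_subset
      (Set.singleton_subset_iff.2 Set.self_mem_Ici) (Set.Ici_subset_Ici.2 hy.le)) le_rfl)
  have hlim : Tendsto (fun y : ℝ ↦ ν ({x} ×ˢ Set.univ) + ENNReal.ofReal (C / y ^ κ)) (𝓝[>] x)
      (𝓝 (ν ({x} ×ˢ Set.univ) + ENNReal.ofReal (C / x ^ κ))) :=
    (ENNReal.tendsto_ofReal ((tendsto_const_nhds.div
      (Real.continuousAt_rpow_const x κ (Or.inl hx.ne')).tendsto
      (Real.rpow_pos_of_pos hx κ).ne').mono_left nhdsWithin_le_nhds)).const_add _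
  have hle := le_of_tendsto hlim (eventually_nhdsWithin_of_forall hsum)
  exact nonpos_iff_eq_zero.1
    ((ENNReal.cancel_of_ne ENNReal.ofReal_ne_top).add_le_iff_nonpos_left.1 hle)

lemma measure_univ_prod_Ioi_ne_zero (hν : IsStableMeasure κ C R P ν) (hR : Measurable R)
    (hR0 : ∀ ω, 0 < R ω) (hκ : 0 < κ) (hC : 0 < C) : ν (Set.univ ×ˢ Set.Ioi 0) ≠ 0 := fun h0 ↦ by
  have htop := hν.measure_Ioi_prod_univ hR hR0 hκ hC
  rw [measure_mono_null (t := (Set.univ ×ˢ Set.Ioi (0 : ℝ)) ∪ {p | 0 < p.2}ᶜ)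
    (fun p _ ↦ (lt_or_ge 0 p.2).imp (fun h ↦ ⟨trivial, h⟩) not_lt_of_ge)
    (measure_union_null h0 hν.ae_snd_pos)] at htop
  exact ENNReal.zero_ne_top htop

end IsStableMeasure

/-! ### Exchangeable increments -/

/-- The value of `u k j d` for the pair `(k, j)` with `d ∈ crossingMax k j`, and `0` if there is no
such pair. The pair is unique, hence the sum has at most one nonzero term, when the second
coordinates of `d` are nonnegative. -/
def atCrossingMax (u : ℕ → ℕ → (ℕ → ℝ × ℝ) → ℝ≥0∞) (d : ℕ → ℝ × ℝ) : ℝ≥0∞ :=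
  ∑' k, ∑ j ∈ Finset.range k, (crossingMax k j).indicator (u k j) d

@[fun_prop]
lemma measurable_crossingData (k j : ℕ) : Measurable (crossingData k j) := by
  unfold crossingData
  fun_prop

lemma measurableSet_crossingMax (k j : ℕ) : MeasurableSet (crossingMax k j) := by
  unfold crossingMax IsStrictMax
  measurability

lemma measurable_atCrossingMax {u : ℕ → ℕ → (ℕ → ℝ × ℝ) → ℝ≥0∞}
    (hu : ∀ k j, Measurable (u k j)) : Measurable (atCrossingMax u) :=
  Measurable.tsum fun k ↦ Finset.measurable_fun_sum _ fun j _ ↦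
    (hu k j).indicator (measurableSet_crossingMax k j)

lemma IsStrictMax.unique {d : ℕ → ℝ} {k i j : ℕ} (hi : IsStrictMax d k i)
    (hj : IsStrictMax d k j) : i = j := by
  by_contra h
  exact lt_asymm (hi.2 j hj.1 (Ne.symm h)) (hj.2 i hi.1 h)

section Nonneg

variable {u : ℕ → ℕ → (ℕ → ℝ × ℝ) → ℝ≥0∞} {d : ℕ → ℝ × ℝ} {k l i j : ℕ}

lemma crossingMax_index_unique (hd : ∀ i, 0 ≤ (d i).2) (hk : d ∈ crossingMax k i)
    (hl : d ∈ crossingMax l j) : k = l := by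
  have hmono : Monotone fun n ↦ ∑ i ∈ Finset.range n, (d i).2 := fun m n hmn ↦
    Finset.sum_le_sum_of_subset_of_nonneg (Finset.range_mono hmn) fun i _ _ ↦ hd i
  have hle {k l i j : ℕ} (hk : d ∈ crossingMax k i) (hl : d ∈ crossingMax l j) : k ≤ l :=
    Nat.lt_succ_iff.1 (hmono.reflect_lt (hk.1.1.trans_lt hl.1.2))
  exact (hle hk hl).antisymm (hle hl hk)

lemma atCrossingMax_eq (hd : ∀ i, 0 ≤ (d i).2) (h : d ∈ crossingMax k j) :
    atCrossingMax u d = u k j d := by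
  rw [atCrossingMax, tsum_eq_single k fun l hl ↦ Finset.sum_eq_zero fun i _ ↦
    Set.indicator_of_notMem (fun h' ↦ hl (crossingMax_index_unique hd h' h)) _,
    Finset.sum_eq_single j (fun i _ hi ↦
      Set.indicator_of_notMem (fun h' ↦ hi (h'.2.unique h.2)) _)
      (fun hj ↦ absurd (Finset.mem_range.2 h.2.1) hj), Set.indicator_of_mem h]

lemma atCrossingMax_le {c : ℝ≥0∞} (hd : ∀ i, 0 ≤ (d i).2) (hu : ∀ k j, u k j d ≤ c) :
    atCrossingMax u d ≤ c := by
  by_cases h : ∃ k j, d ∈ crossingMax k j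
  · obtain ⟨k, j, h⟩ := h
    exact (atCrossingMax_eq hd h).trans_le (hu k j)
  · push Not at h
    simp [atCrossingMax, Set.indicator_of_notMem (h _ _)]

end Nonneg

section Permutation

variable {d : ℕ → ℝ × ℝ} {σ : Equiv.Perm ℕ} {k j n : ℕ}

lemma perm_lt_iff (hσ : ∀ l, k ≤ l → σ l = l) {l : ℕ} : σ l < k ↔ l < k := by
  refine not_iff_not.1 ⟨fun h ↦ ?_, fun h ↦ ?_⟩
  · rwa [σ.injective (hσ _ (not_lt.1 h))] at h
  · rwa [hσ l (not_lt.1 h)]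

lemma sum_range_comp_perm {M : Type*} [AddCommMonoid M] (f : ℕ → M)
    (hσ : ∀ l, k ≤ l → σ l = l) (hn : k ≤ n) :
    ∑ l ∈ Finset.range n, f (σ l) = ∑ l ∈ Finset.range n, f l := by
  refine Equiv.Perm.sum_comp σ (Finset.range n) f fun l hl ↦ ?_
  contrapose! hl
  simpa using hσ l (hn.trans (by simpa using hl))

lemma isStrictMax_comp_perm_iff {d : ℕ → ℝ} (hσ : ∀ l, k ≤ l → σ l = l) :
    IsStrictMax (d ∘ σ) k j ↔ IsStrictMax d k (σ j) := by
  rw [IsStrictMax, IsStrictMax,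
    σ.surjective.forall (p := fun i ↦ i < k → i ≠ σ j → d i < d (σ j))]
  simp only [perm_lt_iff hσ, σ.injective.ne_iff, Function.comp_apply]

lemma comp_perm_mem_crossingMax_iff (hσ : ∀ l, k ≤ l → σ l = l) :
    d ∘ σ ∈ crossingMax k j ↔ d ∈ crossingMax k (σ j) := by
  have hsum {n : ℕ} (hn : k ≤ n) := sum_range_comp_perm (fun i ↦ (d i).2) hσ hn
  have hmax := isStrictMax_comp_perm_iff (d := fun i ↦ (d i).1) (j := j) hσ
  simp only [crossingMax, Set.mem_ofPred, ← hmax, ← hsum le_rfl, ← hsum k.le_succ]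
  rfl

lemma crossingData_comp_perm (hσ : ∀ l, k ≤ l → σ l = l) :
    crossingData k j (d ∘ σ) = crossingData k (σ j) d := by
  simp [crossingData, sum_range_comp_perm (fun i ↦ (d i).2) hσ le_rfl, hσ k le_rfl]

end Permutation

section Average

variable {Q : Measure (ℕ → ℝ × ℝ)} {g : ℝ × ℝ × ℝ × ℝ → ℝ≥0∞}

lemma setLIntegral_crossingMax_eq
    (hQ : ∀ i j, MeasurePreserving (fun d : ℕ → ℝ × ℝ ↦ d ∘ Equiv.swap i j) Q Q)
    (hg : Measurable g) {k i j : ℕ} (hi : i < k) (hj : j < k) :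
    ∫⁻ d in crossingMax k i, g (crossingData k i d) ∂Q =
      ∫⁻ d in crossingMax k j, g (crossingData k j d) ∂Q := by
  have hσ : ∀ l, k ≤ l → Equiv.swap i j l = l := fun l hl ↦
    Equiv.swap_apply_of_ne_of_ne (by omega) (by omega)
  have hpre : (fun d : ℕ → ℝ × ℝ ↦ d ∘ Equiv.swap i j) ⁻¹' crossingMax k j = crossingMax k i := by
    ext d
    rw [Set.mem_preimage, comp_perm_mem_crossingMax_iff hσ, Equiv.swap_apply_right]
  rw [← (hQ i j).setLIntegral_comp_preimage (measurableSet_crossingMax k j) (by fun_prop), hpre]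
  simp only [crossingData_comp_perm hσ, Equiv.swap_apply_right]

lemma lintegral_atCrossingMax_mul (hg : Measurable g) (w : ℕ → ℕ → ℝ≥0∞) :
    ∫⁻ d, atCrossingMax (fun k j d ↦ w k j * g (crossingData k j d)) d ∂Q =
      ∑' k, ∑ j ∈ Finset.range k,
        w k j * ∫⁻ d in crossingMax k j, g (crossingData k j d) ∂Q := by
  have hm : ∀ k j, Measurable ((crossingMax k j).indicator
      fun d ↦ w k j * g (crossingData k j d)) := fun k j ↦
    Measurable.indicator (by fun_prop) (measurableSet_crossingMax k j)
  simp only [atCrossingMax]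
  rw [lintegral_tsum fun k ↦ (Finset.measurable_fun_sum _ fun j _ ↦ hm k j).aemeasurable]
  refine tsum_congr fun k ↦ ?_
  rw [lintegral_finsetSum _ fun j _ ↦ hm k j]
  refine Finset.sum_congr rfl fun j _ ↦ ?_
  rw [lintegral_indicator (measurableSet_crossingMax k j), lintegral_const_mul _ (by fun_prop)]

theorem lintegral_atCrossingMax_eq_average
    (hQ : ∀ i j, MeasurePreserving (fun d : ℕ → ℝ × ℝ ↦ d ∘ Equiv.swap i j) Q Q)
    (hg : Measurable g) (w : ℕ → ℕ → ℝ≥0∞) :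
    ∫⁻ d, atCrossingMax (fun k j d ↦ w k j * g (crossingData k j d)) d ∂Q =
      ∫⁻ d, atCrossingMax (fun k j d ↦ (∑ i ∈ Finset.range k, w k i) / k *
        g (crossingData k j d)) d ∂Q := by
  rw [lintegral_atCrossingMax_mul hg, lintegral_atCrossingMax_mul hg]
  refine tsum_congr fun k ↦ ?_
  rcases Nat.eq_zero_or_pos k with rfl | hk
  · simp
  have hfactor (v : ℕ → ℝ≥0∞) :
      ∑ j ∈ Finset.range k, v j * ∫⁻ d in crossingMax k j, g (crossingData k j d) ∂Q =
        (∑ j ∈ Finset.range k, v j) * ∫⁻ d in crossingMax k 0, g (crossingData k 0 d) ∂Q := by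
    rw [Finset.sum_mul]
    exact Finset.sum_congr rfl fun j hj ↦ by
      rw [setLIntegral_crossingMax_eq hQ hg (Finset.mem_range.1 hj) hk]
  rw [hfactor, hfactor fun _ ↦ (∑ i ∈ Finset.range k, w k i) / k, Finset.sum_const,
    Finset.card_range, nsmul_eq_mul,
    ENNReal.mul_div_cancel (by exact_mod_cast hk.ne') (ENNReal.natCast_ne_top k)]

end Average

lemma measurePreserving_comp_perm_of_iIndepFun {ι Ω E : Type*} [Countable ι] [MeasurableSpace Ω]
    [MeasurableSpace E] {P : Measure Ω} {D : ι → Ω → E}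
    (hm : ∀ i, Measurable (D i)) (hind : iIndepFun D P)
    (hid : ∀ i j, IdentDistrib (D i) (D j) P P) (σ : Equiv.Perm ι) :
    MeasurePreserving (fun d : ι → E ↦ d ∘ σ) (P.map fun ω i ↦ D i ω)
      (P.map fun ω i ↦ D i ω) := by
  have hσ : Measurable fun d : ι → E ↦ d ∘ σ := measurable_pi_lambda _ fun i ↦
    measurable_pi_apply (σ i)
  refine ⟨hσ, ?_⟩
  rw [Measure.map_map hσ (measurable_pi_lambda _ hm)]
  exact (IdentDistrib.pi (fun i ↦ hid (σ i) i) (hind.precomp σ.injective) hind).map_eq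

/-! ### Riemann sums and product laws -/

section RiemannSums

open scoped BoundedContinuousFunction

lemma ext_of_lintegral_mul_boundedContinuousFunction {X Y : Type*}
    [MeasurableSpace X] [TopologicalSpace X] [BorelSpace X] [HasOuterApproxClosed X]
    [MeasurableSpace Y] [TopologicalSpace Y] [BorelSpace Y] [HasOuterApproxClosed Y]
    {μ ν : Measure (X × Y)} [IsFiniteMeasure μ]
    (h : ∀ (f : X →ᵇ ℝ≥0) (g : Y →ᵇ ℝ≥0),
      ∫⁻ p, (f p.1 : ℝ≥0∞) * g p.2 ∂μ = ∫⁻ p, (f p.1 : ℝ≥0∞) * g p.2 ∂ν) :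
    μ = ν := by
  -- The library states this for finite families of spaces on each side.
  let e : (X × Y) ≃ᵐ ((Unit → X) × (Unit → Y)) :=
    .symm <| .prodCongr (.funUnique ..) (.funUnique ..)
  rw [← e.map_measurableEquiv_injective.eq_iff]
  have : IsFiniteMeasure (μ.map e) := Measure.isFiniteMeasure_map _ _
  refine Measure.ext_of_lintegral_prod_mul_prod_boundedContinuousFunction fun f g ↦ ?_
  rw [lintegral_map_equiv, lintegral_map_equiv]
  simp only [Finset.univ_unique, Finset.prod_singleton]
  exact h (f ()) (g ())

lemma ceil_mul_eq_add_one_iff {k : ℕ} (hk : 0 < k) {j : ℕ} {x : ℝ} :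
    ⌈x * k⌉₊ = j + 1 ↔ x ∈ Set.Ioc ((j : ℝ) / k) (((j + 1 : ℕ) : ℝ) / k) := by
  have hk' : (0 : ℝ) < k := by exact_mod_cast hk
  rw [Nat.ceil_eq_iff j.succ_ne_zero, Set.mem_Ioc, div_lt_iff₀ hk', le_div_iff₀ hk',
    Nat.succ_sub_one]

lemma Ioc_zero_one_eq_biUnion {k : ℕ} (hk : 0 < k) :
    Set.Ioc (0 : ℝ) 1 =
      ⋃ j ∈ Finset.range k, Set.Ioc ((j : ℝ) / k) (((j + 1 : ℕ) : ℝ) / k) := by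
  have hk' : (0 : ℝ) < k := by exact_mod_cast hk
  ext x
  simp only [Set.mem_iUnion, Finset.mem_range, exists_prop, ← ceil_mul_eq_add_one_iff hk]
  have hpos : 0 < x ↔ 0 < ⌈x * k⌉₊ := by rw [Nat.ceil_pos, mul_pos_iff_of_pos_right hk']
  have hle : x ≤ 1 ↔ ⌈x * k⌉₊ ≤ k := by rw [Nat.ceil_le, mul_le_iff_le_one_left hk']
  rw [Set.mem_Ioc, hpos, hle]
  exact ⟨fun h ↦ ⟨⌈x * k⌉₊ - 1, by omega, by omega⟩, fun ⟨_, _, _⟩ ↦ by omega⟩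

lemma lintegral_ceil_eq_average (f : ℝ → ℝ≥0∞) {k : ℕ} (hk : 0 < k) :
    ∫⁻ x in Set.Ioc (0 : ℝ) 1, f (⌈x * k⌉₊ / k) =
      (∑ j ∈ Finset.range k, f (((j + 1 : ℕ) : ℝ) / k)) / k := by
  have hk' : (0 : ℝ) < k := by exact_mod_cast hk
  rw [Ioc_zero_one_eq_biUnion hk, lintegral_biUnion_finset (fun i _ j _ hij ↦ ?_)
    (fun j _ ↦ measurableSet_Ioc), ENNReal.div_eq_inv_mul, Finset.mul_sum]
  · refine Finset.sum_congr rfl fun j _ ↦ ?_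
    have hlen : ((j + 1 : ℕ) : ℝ) / k - j / k = (k : ℝ)⁻¹ := by
      push_cast
      ring
    rw [setLIntegral_congr_fun (g := fun _ ↦ f (((j + 1 : ℕ) : ℝ) / k)) measurableSet_Ioc
      fun x hx ↦ by rw [(ceil_mul_eq_add_one_iff hk).2 hx], setLIntegral_const, Real.volume_Ioc,
      mul_comm, hlen, ENNReal.ofReal_inv_of_pos hk', ENNReal.ofReal_natCast]
  · refine Set.disjoint_left.2 fun x hi hj ↦ hij ?_
    have := (ceil_mul_eq_add_one_iff hk).2 hi
    have := (ceil_mul_eq_add_one_iff hk).2 hj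
    omega

lemma tendsto_average_lintegral (f : ℝ →ᵇ ℝ≥0) :
    Tendsto (fun k : ℕ ↦ (∑ j ∈ Finset.range k, (f (((j + 1 : ℕ) : ℝ) / k) : ℝ≥0∞)) / k) atTop
      (𝓝 (∫⁻ x in Set.Icc (0 : ℝ) 1, f x)) := by
  rw [setLIntegral_congr Ioc_ae_eq_Icc.symm]
  have h : Tendsto (fun k : ℕ ↦ ∫⁻ x in Set.Ioc (0 : ℝ) 1, (f (⌈x * k⌉₊ / k) : ℝ≥0∞)) atTop
      (𝓝 (∫⁻ x in Set.Ioc (0 : ℝ) 1, f x)) := by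
    refine tendsto_lintegral_of_dominated_convergence (fun _ ↦ (nndist 0 f : ℝ≥0∞))
      (fun k ↦ (f.continuous.measurable.comp (by fun_prop)).coe_nnreal_ennreal)
      (fun k ↦ Eventually.of_forall fun x ↦ ENNReal.coe_le_coe.2 (f.apply_le_nndist_zero _))
      (by simp) ?_
    filter_upwards [ae_restrict_mem measurableSet_Ioc] with x hx
    refine ENNReal.tendsto_coe.2 ((f.continuous.tendsto x).comp ?_)
    exact (tendsto_nat_ceil_mul_div_atTop (R := ℝ) hx.1.le).comp tendsto_natCast_atTop_atTop
  refine h.congr' ?_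
  filter_upwards [eventually_gt_atTop 0] with k hk
  exact lintegral_ceil_eq_average (fun x ↦ f x) hk

end RiemannSums

/-! ### The law of the relative position -/

lemma firstAbove_lt_iff_of_dense {f : ℝ≥0 → ℝ} (hf : Monotone f) {a : ℝ} (hex : ∃ x, a < f x)
    {D : Set ℝ≥0} (hD : Dense D) {c : ℝ≥0} : firstAbove f a < c ↔ ∃ q ∈ D, q < c ∧ a < f q := by
  refine ⟨fun h ↦ ?_, fun ⟨q, _, hqc, hq⟩ ↦ (firstAbove_le hq).trans_lt hqc⟩
  obtain ⟨q, hqD, hq⟩ := hD.exists_between h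
  exact ⟨q, hqD, hq.2, lt_of_firstAbove_lt hf hex hq.1⟩

namespace IsRegularPath

variable {f₁ f₂ : ℝ≥0 → ℝ} {δ : ℕ → ℝ≥0}

lemma tendsto_atCrossingMax (h : IsRegularPath f₁ f₂) (hδ₀ : ∀ n, 0 < δ n)
    (hδ : Tendsto δ atTop (𝓝 0)) (hT : ∀ n (k : ℕ), firstAbove f₂ 1 ≠ k * δ n)
    {u : ℕ → ℕ → (ℕ → ℝ × ℝ) → ℝ≥0∞} {l : ℝ≥0∞}
    (hu : ∀ (k j : ℕ → ℕ) (d : ℕ → ℕ → ℝ × ℝ), Tendsto k atTop atTop →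
      Tendsto (fun n ↦ ((j n + 1 : ℕ) : ℝ) / k n) atTop (𝓝 (relPosition f₁ f₂)) →
      Tendsto (fun n ↦ crossingData (k n) (j n) (d n)) atTop (𝓝 (passageData f₁ f₂)) →
      Tendsto (fun n ↦ u (k n) (j n) (d n)) atTop (𝓝 l)) :
    Tendsto (fun n ↦ atCrossingMax u (gridIncr (fun t ↦ (f₁ t, f₂ t)) (δ n))) atTop (𝓝 l) := by
  obtain ⟨k, j, hmem, hk, hj, hdata⟩ := h.exists_tendsto_crossingData hδ₀ hδ hT
  refine (hu k j _ hk hj hdata).congr' ?_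
  filter_upwards [hmem] with n hn
  rw [atCrossingMax_eq (h.gridIncr_snd_nonneg _) hn]

lemma tendsto_toReal_atCrossingMax_sub (h : IsRegularPath f₁ f₂) (hδ₀ : ∀ n, 0 < δ n)
    (hδ : Tendsto δ atTop (𝓝 0)) (hT : ∀ n (k : ℕ), firstAbove f₂ 1 ≠ k * δ n)
    {φ : ℝ × ℝ × ℝ × ℝ × ℝ → ℝ} (hφ : Continuous φ) :
    Tendsto (fun n ↦
      (atCrossingMax (fun k j d ↦ ENNReal.ofReal (φ (((j + 1 : ℕ) : ℝ) / k, crossingData k j d)))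
        (gridIncr (fun t ↦ (f₁ t, f₂ t)) (δ n))).toReal -
      (atCrossingMax (fun k j d ↦ ENNReal.ofReal (-φ (((j + 1 : ℕ) : ℝ) / k, crossingData k j d)))
        (gridIncr (fun t ↦ (f₁ t, f₂ t)) (δ n))).toReal) atTop
      (𝓝 (φ (relPosition f₁ f₂, passageData f₁ f₂))) := by
  have hlim {φ : ℝ × ℝ × ℝ × ℝ × ℝ → ℝ} (hφ : Continuous φ) :=
    (ENNReal.tendsto_toReal ENNReal.ofReal_ne_top).comp (h.tendsto_atCrossingMax hδ₀ hδ hT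
      (u := fun k j d ↦ ENNReal.ofReal (φ (((j + 1 : ℕ) : ℝ) / k, crossingData k j d)))
      fun k j d _ hj hd ↦ ENNReal.tendsto_ofReal ((hφ.tendsto _).comp (hj.prodMk_nhds hd)))
  simpa only [Function.comp_def, Pi.neg_apply, ENNReal.toReal_ofReal',
    max_zero_sub_max_neg_zero_eq_self] using
    (hlim hφ).sub (hlim hφ.neg)

end IsRegularPath

section LevyPair

open scoped BoundedContinuousFunction

variable {Ω : Type*} [MeasurableSpace Ω] {P : Measure Ω} {Y₁ Y₂ : ℝ≥0 → Ω → ℝ}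

lemma nullMeasurable_firstAbove {X : ℝ≥0 → Ω → ℝ} (hX : ∀ t, Measurable (X t)) {a : ℝ}
    (hmono : ∀ᵐ ω ∂P, Monotone (X · ω)) (hex : ∀ᵐ ω ∂P, ∃ x, a < X x ω) :
    NullMeasurable (fun ω ↦ firstAbove (X · ω) a) P := by
  obtain ⟨D, hDc, hD⟩ := TopologicalSpace.exists_countable_dense ℝ≥0
  refine measurable_of_Iio (δ := NullMeasurableSpace Ω P) fun c ↦ ?_
  have hmeas : MeasurableSet (⋃ q ∈ D, {ω | q < c ∧ a < X q ω}) :=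
    .biUnion hDc fun q _ ↦ (MeasurableSet.const _).inter (measurableSet_lt measurable_const (hX q))
  refine hmeas.nullMeasurableSet.congr (eventuallyEq_set.2 ?_)
  filter_upwards [hmono, hex] with ω hω hexω
  rw [Set.mem_iUnion₂]
  simpa only [exists_prop] using! (firstAbove_lt_iff_of_dense hω hexω hD).symm

lemma exists_grid_avoiding [IsFiniteMeasure P] {τ : Ω → ℝ≥0} (hτ : NullMeasurable τ P)
    (hpos : ∀ᵐ ω ∂P, 0 < τ ω) :
    ∃ δ : ℕ → ℝ≥0, (∀ n, 0 < δ n) ∧ Tendsto δ atTop (𝓝 0) ∧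
      ∀ᵐ ω ∂P, ∀ n (k : ℕ), τ ω ≠ k * δ n := by
  have hatoms : {t | 0 < P {ω | τ ω = t}}.Countable := Measure.countable_meas_level_set_pos₀ hτ
  have hbad : (⋃ p : ℕ × ℕ, (fun h : ℝ≥0 ↦ (p.2 + 1 : ℕ) * (h / (p.1 + 1))) ⁻¹'
      {t | 0 < P {ω | τ ω = t}}).Countable := Set.countable_iUnion fun p ↦
    hatoms.preimage fun x y hxy ↦ by
      have : (p.1 + 1 : ℝ≥0) ≠ 0 := by positivity
      simpa [div_left_inj' this, Nat.cast_add_one_ne_zero] using hxy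
  obtain ⟨h, hgood, hh : 0 < h⟩ :=
    ((hbad.image ((↑) : ℝ≥0 → ℝ)).dense_compl ℝ).exists_mem_open isOpen_Ioi ⟨1, zero_lt_one' ℝ⟩
  lift h to ℝ≥0 using hh.le
  refine ⟨fun n ↦ h / (n + 1), fun n ↦ div_pos (mod_cast hh) (by positivity), ?_, ?_⟩
  · simpa [div_eq_mul_inv] using
      (tendsto_one_div_add_atTop_nhds_zero_nat (𝕜 := ℝ≥0)).const_mul h
  have hnull : ∀ n k : ℕ, ∀ᵐ ω ∂P, τ ω ≠ (k + 1 : ℕ) * (h / (n + 1)) := fun n k ↦ by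
    refine measure_eq_zero_iff_ae_notMem.1 (nonpos_iff_eq_zero.1 (not_lt.1 fun hlt ↦ hgood ?_))
    exact Set.mem_image_of_mem _ (Set.mem_iUnion.2 ⟨(n, k), hlt⟩)
  filter_upwards [ae_all_iff.2 fun n ↦ ae_all_iff.2 (hnull n), hpos] with ω hω h0 n k
  rcases k with _ | k
  · simpa using h0.ne'
  · exact hω n k

lemma exists_grid_avoiding_firstAbove [IsFiniteMeasure P] (hY₂ : ∀ t, Measurable (Y₂ t))
    (hreg : ∀ᵐ ω ∂P, IsRegularPath (Y₁ · ω) (Y₂ · ω)) :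
    ∃ δ : ℕ → ℝ≥0, (∀ n, 0 < δ n) ∧ Tendsto δ atTop (𝓝 0) ∧
      ∀ᵐ ω ∂P, ∀ n (k : ℕ), firstAbove (Y₂ · ω) 1 ≠ k * δ n :=
  exists_grid_avoiding (nullMeasurable_firstAbove hY₂ (hreg.mono fun _ h ↦ h.mono₂)
    (hreg.mono fun _ h ↦ h.exceeds)) (hreg.mono fun _ h ↦ h.firstAbove_pos)

lemma IsLevyProcess.measurable_gridIncr_pair
    (hY : IsLevyProcess (fun t ω ↦ (Y₁ t ω, Y₂ t ω)) P) (δ : ℝ≥0) :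
    Measurable fun ω ↦ gridIncr (fun t ↦ (Y₁ t ω, Y₂ t ω)) δ :=
  measurable_pi_lambda _ fun j ↦ hY.measurable_gridIncr δ j

lemma aemeasurable_comp_relPosition_passageData [IsFiniteMeasure P]
    (hY : IsLevyProcess (fun t ω ↦ (Y₁ t ω, Y₂ t ω)) P)
    (hreg : ∀ᵐ ω ∂P, IsRegularPath (Y₁ · ω) (Y₂ · ω))
    {φ : ℝ × ℝ × ℝ × ℝ × ℝ → ℝ} (hφ : Continuous φ) :
    AEMeasurable (fun ω ↦ φ (relPosition (Y₁ · ω) (Y₂ · ω), passageData (Y₁ · ω) (Y₂ · ω))) P := by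
  obtain ⟨δ, hδ₀, hδ, hT⟩ :=
    exists_grid_avoiding_firstAbove (fun t ↦ (hY.measurable t).snd) hreg
  have hmeas {φ : ℝ × ℝ × ℝ × ℝ × ℝ → ℝ} (hφ : Continuous φ) (n : ℕ) :=
    ((measurable_atCrossingMax (u := fun k j d ↦
      ENNReal.ofReal (φ (((j + 1 : ℕ) : ℝ) / k, crossingData k j d)))
      fun k j ↦ (hφ.measurable.comp (by fun_prop)).ennreal_ofReal).comp
        (hY.measurable_gridIncr_pair (δ n))).ennreal_toReal
  refine aemeasurable_of_tendsto_metrizable_ae atTop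
    (fun n ↦ ((hmeas hφ n).sub (hmeas hφ.neg n)).aemeasurable) ?_
  filter_upwards [hreg, hT] with ω hω hTω
  exact hω.tendsto_toReal_atCrossingMax_sub hδ₀ hδ hTω hφ

lemma aemeasurable_relPosition_prodMk_passageData [IsFiniteMeasure P]
    (hY : IsLevyProcess (fun t ω ↦ (Y₁ t ω, Y₂ t ω)) P)
    (hreg : ∀ᵐ ω ∂P, IsRegularPath (Y₁ · ω) (Y₂ · ω)) :
    AEMeasurable (fun ω ↦ (relPosition (Y₁ · ω) (Y₂ · ω), passageData (Y₁ · ω) (Y₂ · ω))) P := by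
  have h := fun {φ : ℝ × ℝ × ℝ × ℝ × ℝ → ℝ} (hφ : Continuous φ) ↦
    aemeasurable_comp_relPosition_passageData hY hreg hφ
  exact (h continuous_fst).prodMk ((h (φ := fun p ↦ p.2.1) (by fun_prop)).prodMk
    ((h (φ := fun p ↦ p.2.2.1) (by fun_prop)).prodMk
      ((h (φ := fun p ↦ p.2.2.2.1) (by fun_prop)).prodMk
        (h (φ := fun p ↦ p.2.2.2.2) (by fun_prop)))))

lemma tendsto_lintegral_atCrossingMax_mul [IsFiniteMeasure P]
    (hY : IsLevyProcess (fun t ω ↦ (Y₁ t ω, Y₂ t ω)) P)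
    (hreg : ∀ᵐ ω ∂P, IsRegularPath (Y₁ · ω) (Y₂ · ω)) {δ : ℕ → ℝ≥0} (hδ₀ : ∀ n, 0 < δ n)
    (hδ : Tendsto δ atTop (𝓝 0)) (hT : ∀ᵐ ω ∂P, ∀ n (k : ℕ), firstAbove (Y₂ · ω) 1 ≠ k * δ n)
    {w : ℕ → ℕ → ℝ≥0∞} {c : ℝ≥0} (hw : ∀ k j, w k j ≤ c) {l : Ω → ℝ≥0∞}
    (hwl : ∀ ω, ∀ k j : ℕ → ℕ, Tendsto k atTop atTop →
      Tendsto (fun n ↦ ((j n + 1 : ℕ) : ℝ) / k n) atTop (𝓝 (relPosition (Y₁ · ω) (Y₂ · ω))) →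
      Tendsto (fun n ↦ w (k n) (j n)) atTop (𝓝 (l ω)))
    (g : ℝ × ℝ × ℝ × ℝ →ᵇ ℝ≥0) :
    Tendsto (fun n ↦ ∫⁻ ω, atCrossingMax (fun k j d ↦ w k j * g (crossingData k j d))
      (gridIncr (fun t ↦ (Y₁ t ω, Y₂ t ω)) (δ n)) ∂P) atTop
      (𝓝 (∫⁻ ω, l ω * g (passageData (Y₁ · ω) (Y₂ · ω)) ∂P)) := by
  have hgm : Measurable fun p ↦ (g p : ℝ≥0∞) := g.continuous.measurable.coe_nnreal_ennreal
  refine tendsto_lintegral_of_dominated_convergence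
    (fun _ ↦ (c : ℝ≥0∞) * (nndist 0 g : ℝ≥0∞)) (fun n ↦ ?_) (fun n ↦ ?_) ?_ ?_
  · exact (measurable_atCrossingMax fun k j ↦
      (hgm.comp (measurable_crossingData k j)).const_mul _).comp (hY.measurable_gridIncr_pair (δ n))
  · filter_upwards [hreg] with ω hω
    exact atCrossingMax_le (hω.gridIncr_snd_nonneg _) fun k j ↦
      mul_le_mul' (hw k j) (ENNReal.coe_le_coe.2 (g.apply_le_nndist_zero _))
  · rw [lintegral_const]
    exact ENNReal.mul_ne_top (ENNReal.mul_ne_top ENNReal.coe_ne_top ENNReal.coe_ne_top)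
      (measure_ne_top P _)
  · filter_upwards [hreg, hT] with ω hω hTω
    refine hω.tendsto_atCrossingMax hδ₀ hδ hTω fun k j d hk hj hd ↦ ?_
    have hl : l ω ≤ c := le_of_tendsto' (hwl ω k j hk hj) fun n ↦ hw _ _
    exact ENNReal.Tendsto.mul (hwl ω k j hk hj) (Or.inr ENNReal.coe_ne_top)
      (ENNReal.tendsto_coe.2 ((g.continuous.tendsto _).comp hd))
      (Or.inr (ne_top_of_le_ne_top ENNReal.coe_ne_top hl))

lemma IsLevyProcess.lintegral_atCrossingMax_gridIncr_eq_average
    (hY : IsLevyProcess (fun t ω ↦ (Y₁ t ω, Y₂ t ω)) P) (δ : ℝ≥0)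
    {g : ℝ × ℝ × ℝ × ℝ → ℝ≥0∞} (hg : Measurable g) (w : ℕ → ℕ → ℝ≥0∞) :
    ∫⁻ ω, atCrossingMax (fun k j d ↦ w k j * g (crossingData k j d))
        (gridIncr (fun t ↦ (Y₁ t ω, Y₂ t ω)) δ) ∂P =
      ∫⁻ ω, atCrossingMax (fun k j d ↦ (∑ i ∈ Finset.range k, w k i) / k *
        g (crossingData k j d)) (gridIncr (fun t ↦ (Y₁ t ω, Y₂ t ω)) δ) ∂P := by
  have hexch (i j : ℕ) := measurePreserving_comp_perm_of_iIndepFun (hY.measurable_gridIncr δ)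
    (hY.iIndepFun_gridIncr δ)
    (fun i j ↦ (hY.identDistrib_gridIncr δ i).trans (hY.identDistrib_gridIncr δ j).symm)
    (Equiv.swap i j)
  have hmap (v : ℕ → ℕ → ℝ≥0∞) := lintegral_map (μ := P)
    (measurable_atCrossingMax (u := fun k j d ↦ v k j * g (crossingData k j d)) fun k j ↦
      (hg.comp (measurable_crossingData k j)).const_mul _) (hY.measurable_gridIncr_pair δ)
  rw [← hmap w, ← hmap fun k _ ↦ (∑ i ∈ Finset.range k, w k i) / k]
  exact lintegral_atCrossingMax_eq_average hexch hg w

lemma lintegral_relPosition_mul [IsFiniteMeasure P]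
    (hY : IsLevyProcess (fun t ω ↦ (Y₁ t ω, Y₂ t ω)) P)
    (hreg : ∀ᵐ ω ∂P, IsRegularPath (Y₁ · ω) (Y₂ · ω))
    (f : ℝ →ᵇ ℝ≥0) (g : ℝ × ℝ × ℝ × ℝ →ᵇ ℝ≥0) :
    ∫⁻ ω, (f (relPosition (Y₁ · ω) (Y₂ · ω)) : ℝ≥0∞) * g (passageData (Y₁ · ω) (Y₂ · ω)) ∂P =
      ∫⁻ ω, (∫⁻ x in Set.Icc (0 : ℝ) 1, f x) * g (passageData (Y₁ · ω) (Y₂ · ω)) ∂P := by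
  obtain ⟨δ, hδ₀, hδ, hT⟩ :=
    exists_grid_avoiding_firstAbove (fun t ↦ (hY.measurable t).snd) hreg
  have hle (x : ℝ) : (f x : ℝ≥0∞) ≤ nndist 0 f := ENNReal.coe_le_coe.2 (f.apply_le_nndist_zero x)
  have hposition := tendsto_lintegral_atCrossingMax_mul hY hreg hδ₀ hδ hT
    (w := fun k j ↦ f (((j + 1 : ℕ) : ℝ) / k)) (fun _ _ ↦ hle _)
    (fun ω k j _ hj ↦ ENNReal.tendsto_coe.2 ((f.continuous.tendsto _).comp hj)) g
  have haverage := tendsto_lintegral_atCrossingMax_mul hY hreg hδ₀ hδ hT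
    (w := fun k _ ↦ (∑ i ∈ Finset.range k, (f (((i + 1 : ℕ) : ℝ) / k) : ℝ≥0∞)) / k)
    (fun k _ ↦ ENNReal.div_le_of_le_mul ((Finset.sum_le_card_nsmul _ _ _ fun i _ ↦ hle _).trans_eq
      (by rw [Finset.card_range, nsmul_eq_mul, mul_comm])))
    (fun ω k j hk _ ↦ (tendsto_average_lintegral f).comp hk) g
  refine tendsto_nhds_unique hposition (haverage.congr fun n ↦ ?_)
  exact (hY.lintegral_atCrossingMax_gridIncr_eq_average (δ n)
    g.continuous.measurable.coe_nnreal_ennreal fun k j ↦ f (((j + 1 : ℕ) : ℝ) / k)).symm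

theorem map_relPosition_prodMk_passageData [IsFiniteMeasure P]
    (hY : IsLevyProcess (fun t ω ↦ (Y₁ t ω, Y₂ t ω)) P)
    (hreg : ∀ᵐ ω ∂P, IsRegularPath (Y₁ · ω) (Y₂ · ω)) :
    P.map (fun ω ↦ (relPosition (Y₁ · ω) (Y₂ · ω), passageData (Y₁ · ω) (Y₂ · ω))) =
      (volume.restrict (Set.Icc (0 : ℝ) 1)).prod (P.map fun ω ↦ passageData (Y₁ · ω) (Y₂ · ω)) := by
  have hm := aemeasurable_relPosition_prodMk_passageData hY hreg
  have hV : AEMeasurable (fun ω ↦ passageData (Y₁ · ω) (Y₂ · ω)) P := hm.snd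
  have : IsFiniteMeasure (P.map (fun ω ↦ (relPosition (Y₁ · ω) (Y₂ · ω),
      passageData (Y₁ · ω) (Y₂ · ω)))) := Measure.isFiniteMeasure_map _ _
  have : IsFiniteMeasure (P.map fun ω ↦ passageData (Y₁ · ω) (Y₂ · ω)) :=
    Measure.isFiniteMeasure_map _ _
  refine ext_of_lintegral_mul_boundedContinuousFunction fun f g ↦ ?_
  have hf : Measurable fun x ↦ (f x : ℝ≥0∞) := f.continuous.measurable.coe_nnreal_ennreal
  have hg : Measurable fun x ↦ (g x : ℝ≥0∞) := g.continuous.measurable.coe_nnreal_ennreal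
  rw [lintegral_map' (by fun_prop) hm, lintegral_prod_mul hf.aemeasurable hg.aemeasurable,
    lintegral_map' hg.aemeasurable hV]
  exact (lintegral_relPosition_mul hY hreg f g).trans
    (lintegral_const_mul'' _ (hg.comp_aemeasurable hV))

lemma IsLevyMeasure.ae_isRegularPath [IsProbabilityMeasure P] {ν : Measure (ℝ × ℝ)}
    (hν : IsLevyMeasure ν (fun t ω ↦ (Y₁ t ω, Y₂ t ω)) P)
    (hY : IsLevyProcess (fun t ω ↦ (Y₁ t ω, Y₂ t ω)) P)
    (hnn : ∀ t, ∀ᵐ ω ∂P, 0 ≤ Y₁ t ω ∧ 0 ≤ Y₂ t ω)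
    (hν_top : ν (Set.Ioi 0 ×ˢ Set.univ) = ⊤) (hν_atom : ∀ x > 0, ν ({x} ×ˢ Set.univ) = 0)
    (hν_snd : ν (Set.univ ×ˢ Set.Ioi 0) ≠ 0) :
    ∀ᵐ ω ∂P, IsRegularPath (Y₁ · ω) (Y₂ · ω) := by
  have hY₁ : IsLevyProcess Y₁ P := hY.map (ContinuousAddMonoidHom.fst ℝ ℝ)
  have hY₂ : IsLevyProcess Y₂ P := hY.map (ContinuousAddMonoidHom.snd ℝ ℝ)
  have hν₁ : IsLevyMeasure (ν.map Prod.fst) Y₁ P := hν.map hY (ContinuousAddMonoidHom.fst ℝ ℝ)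
  have hν₂ : IsLevyMeasure (ν.map Prod.snd) Y₂ P := hν.map hY (ContinuousAddMonoidHom.snd ℝ ℝ)
  have hnn₂ (t : ℝ≥0) : ∀ᵐ ω ∂P, 0 ≤ Y₂ t ω := (hnn t).mono fun _ h ↦ h.2
  have hmono₁ := hY₁.ae_monotone fun t ↦ (hnn t).mono fun _ h ↦ h.1
  have htop : ν.map Prod.fst (Set.Ioi 0) = ⊤ := by
    rwa [Measure.map_apply measurable_fst measurableSet_Ioi, ← Set.prod_univ]
  have hatom : ∀ x > 0, ν.map Prod.fst {x} = 0 := fun x hx ↦ by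
    rw [Measure.map_apply measurable_fst (measurableSet_singleton x), ← Set.prod_univ,
      hν_atom x hx]
  have hsnd : ν.map Prod.snd (Set.Ioi 0) ≠ 0 := by
    rwa [Measure.map_apply measurable_snd measurableSet_Ioi, ← Set.univ_prod]
  filter_upwards [hmono₁, hY₂.ae_monotone hnn₂, hY₂.zero, hν₂.ae_exists_lt hY₂ hnn₂ hsnd 1,
    hν₁.ae_exists_jump_pos hY₁ hmono₁ htop, hν₁.ae_injOn_jump hY₁ hmono₁ hatom]
    with ω hmono₁ hmono₂ hzero₂ hexceeds hjumps hdistinct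
  exact ⟨hmono₁, hmono₂, fun s ↦ (hY₁.cadlag ω s).1, fun s ↦ (hY₂.cadlag ω s).1, hzero₂,
    hexceeds, hjumps, hdistinct⟩

end LevyPair

end StableJump

end

theorem lemma5p5_general {Ω : Type*} [MeasurableSpace Ω] (P : Measure Ω) [IsProbabilityMeasure P]
    (Y₁ Y₂ : ℝ≥0 → Ω → ℝ)
    (hY : StableJump.IsLevyProcess (fun t ω ↦ (Y₁ t ω, Y₂ t ω)) P)
    (hY_nonneg : ∀ t, ∀ᵐ ω ∂P, 0 ≤ Y₁ t ω ∧ 0 ≤ Y₂ t ω)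
    (ν : Measure (ℝ × ℝ))
    (hY_meas : StableJump.IsLevyMeasure ν (fun t ω ↦ (Y₁ t ω, Y₂ t ω)) P)
    (hν_top : ν (Set.Ioi 0 ×ˢ Set.univ) = ⊤) (hν_atom : ∀ x > 0, ν ({x} ×ˢ Set.univ) = 0)
    (hν_snd : ν (Set.univ ×ˢ Set.Ioi 0) ≠ 0) :
    pdf.IsUniform (fun ω ↦ StableJump.relPosition (Y₁ · ω) (Y₂ · ω))
      (Set.Icc (0 : ℝ) 1) P volume ∧
    AEMeasurable (fun ω ↦ StableJump.passageData (Y₁ · ω) (Y₂ · ω)) P ∧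
    IndepFun (fun ω ↦ StableJump.relPosition (Y₁ · ω) (Y₂ · ω))
      (fun ω ↦ StableJump.passageData (Y₁ · ω) (Y₂ · ω)) P := by
  have hreg := hY_meas.ae_isRegularPath hY hY_nonneg hν_top hν_atom hν_snd
  have hm := StableJump.aemeasurable_relPosition_prodMk_passageData hY hreg
  have hlaw := StableJump.map_relPosition_prodMk_passageData hY hreg
  have : IsProbabilityMeasure (P.map fun ω ↦ StableJump.passageData (Y₁ · ω) (Y₂ · ω)) :=
    Measure.isProbabilityMeasure_map hm.snd
  have hunif : P.map (fun ω ↦ StableJump.relPosition (Y₁ · ω) (Y₂ · ω)) =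
      volume.restrict (Set.Icc (0 : ℝ) 1) := by
    have h := congrArg (Measure.map Prod.fst) hlaw
    rwa [AEMeasurable.map_map_of_aemeasurable measurable_fst.aemeasurable hm, Measure.map_fst_prod,
      measure_univ, one_smul] at h
  refine ⟨?_, hm.snd, (indepFun_iff_map_prod_eq_prod_map_map hm.fst hm.snd).2 (by
    rw [hlaw, hunif])⟩
  rw [pdf.IsUniform, ProbabilityTheory.cond]
  simpa using hunif

theorem lemma5p5 {κ C : ℝ} (hκ₀ : 0 < κ) (hκ₁ : κ < 1) (hC : 0 < C)
    -- the variable `R_κ`, on an auxiliary probability space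
    {Ω' : Type*} [MeasurableSpace Ω'] (P' : Measure Ω') [IsProbabilityMeasure P']
    (W W' : ℝ≥0 → Ω' → ℝ)
    (hW : StableJump.IsConditionedBM κ W P') (hW' : StableJump.IsConditionedBM κ W' P')
    (hind : IndepFun (fun ω t ↦ W t ω) (fun ω t ↦ W' t ω) P')
    -- the measure `ν`
    (ν : Measure (ℝ × ℝ))
    (hν : StableJump.IsStableMeasure κ C (StableJump.expFunctional W W') P' ν)
    -- the pure jump Lévy process `(Y₁, Y₂)` with Lévy measure `ν` and values in `[0, ∞)²`
    {Ω : Type*} [MeasurableSpace Ω] (P : Measure Ω) [IsProbabilityMeasure P]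
    (Y₁ Y₂ : ℝ≥0 → Ω → ℝ)
    (hY : StableJump.IsLevyProcess (fun t ω ↦ (Y₁ t ω, Y₂ t ω)) P)
    (hY_nonneg : ∀ᵐ ω ∂P, ∀ t, 0 ≤ Y₁ t ω ∧ 0 ≤ Y₂ t ω)
    (hY_jump : StableJump.IsPureJump (fun t ω ↦ (Y₁ t ω, Y₂ t ω)) P)
    (hY_meas : StableJump.IsLevyMeasure ν (fun t ω ↦ (Y₁ t ω, Y₂ t ω)) P) :
    pdf.IsUniform
      (fun ω ↦ (StableJump.Fstar (Y₁ · ω) (Y₂ · ω) : ℝ) / StableJump.firstAbove (Y₂ · ω) 1)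
      (Set.Icc (0 : ℝ) 1) P volume ∧
    AEMeasurable
      (fun ω ↦ (StableJump.I₁ (Y₁ · ω) (Y₂ · ω), StableJump.I₂ (Y₁ · ω) (Y₂ · ω))) P ∧
    IndepFun
      (fun ω ↦ (StableJump.Fstar (Y₁ · ω) (Y₂ · ω) : ℝ) / StableJump.firstAbove (Y₂ · ω) 1)
      (fun ω ↦ (StableJump.I₁ (Y₁ · ω) (Y₂ · ω), StableJump.I₂ (Y₁ · ω) (Y₂ · ω))) P := by
  have hR := StableJump.measurable_expFunctional hW.measurable hW.continuous hW'.measurable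
    hW'.continuous
  have hR0 (ω : Ω') : 0 < StableJump.expFunctional W W' ω :=
    StableJump.expFunctional_pos (hW.continuous ω)
  obtain ⟨huniform, hdata, hindep⟩ := lemma5p5_general P Y₁ Y₂ hY
    (fun t ↦ hY_nonneg.mono fun ω h ↦ h t) ν hY_meas
    (hν.measure_Ioi_prod_univ hR hR0 hκ₀ hC)
    (fun x hx ↦ hν.measure_singleton_prod_univ hR hR0 hκ₀.le hC.le hx)
    (hν.measure_univ_prod_Ioi_ne_zero hR hR0 hκ₀ hC)
  have hI : Measurable fun p : ℝ × ℝ × ℝ × ℝ ↦ (p.1, (1 - p.2.1) * (p.2.2.1 / p.2.2.2)) := by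
    fun_prop
  exact ⟨huniform, hI.comp_aemeasurable hdata, hindep.comp measurable_id hI⟩
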